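/- Let $0<q<1/2$, put $\alpha=(1-q)/q$, and consider the Markov chain on $\mathbb{N}_0$ with $p_{0,1}=1$, $p_{y,y+1}=q$ and $p_{y,y-1}=1-q$ for $y\ge 1$, and all other transition probabilities zero. Let $\mathbb{P}_x$ be its law, on $\mathbb{N}_0^{\mathbb{N}_0}$ with canonical process $(X_n)_{n\ge 0}$, when started at $x$. Definitions. Let $T'_0=\inf\{n\ge1: X_n=0\}$, let $G_0(x,y)=\mathbb{E}_x\big[\#\{0\le n<T'_0: X_n=y\}\big]$, $L_0(x,y)=G_0(x,y)/G_0(0,y)$ and $D_0(z)=\sup_y L_0(z,y)$. For a summable family $w=(w_z)$ of positive reals, the Martin compactification is the completion of $\mathbb{N}_0$ for $$\delta_{0,w}(x,y)=\sum_z w_z\,\frac{|L_0(z,x)-L_0(z,y)|+|\mathbf 1_{z=x}-\mathbf 1_{z=y}|}{D_0(z)+1};$$ the Martin boundary is the complement of $\mathbb{N}_0$ in it, and the minimal boundary is the set of boundary points $a$ such that $L_0(\cdot,a)$ (extended by continuity) is minimal among the nonnegative harmonic functions for the killed transitions $p_{x,y}\mathbf 1_{y\ne0}$. If $\beta$ is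 the stationary probability, put $\varphi_{0,a}(x)=\frac{L_0(x,a)}{\beta(0)}\mathbf 1_{x\neq0}$. For $\varphi:\mathbb{N}_0\to[0,\infty)$, $(\mathbb{Q}^{0,\varphi}_x)_x$ denotes a family of $\sigma$-finite measures on $\mathbb{N}_0^{\mathbb{N}_0}$ such that, under $\mathbb{Q}_x^{0,\varphi}$, almost everywhere $X_0=x$ and every state is visited finitely often, and such that $\mathbb{Q}_x^{0,\varphi}(F_n\mathbf 1_{\forall k\ge n,\,X_k\ne0})=\mathbb{E}_x[F_n\varphi(X_n)]$ for all $n\ge0$ and all nonnegative $\sigma(X_0,\dots,X_n)$-measurable $F_n$. A family $(\mathbb{Q}_x)_x$ of $\sigma$-finite measures is in class $\mathcal{Q}$ if for all $n\ge0$ and all states $x,y,x_0,x_1$: (i) $\mathbf 1_{X_n=y}\cdot\mathbb{Q}_x=\mathbf 1_{X_n=y}\cdot(\mathbb{P}^{(n)}_x\circ\mathbb{Q}_y)$, where $\mathbb{P}^{(n)}_x\circ\mathbb{Q}_y$ is the image of $\mathbb{P}_x\otimes\mathbb{Q}_y$ by $(\omega,\eta)\mapsto(\omega_0,\dots,\omega_n,\eta_1,\eta_2,\dots)$;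 (ii) $\mathbb{Q}_x(\forall k\ge 0,\ X_k\ne x_0)<\infty$; (iii) $\mathbb{Q}_{x_1}(X_k=x_0\text{ for infinitely many }k)=0$. Theorem. 1. The chain is irreducible and recurrent. 2. $G_0(0,0)=1$; $G_0(x,0)=0$ for $x>0$; $G_0(0,y)=\frac1{q\alpha^y}$ for $y>0$; $G_0(x,y)=\frac{\alpha^x-1}{(1-2q)\alpha^y}$ for $0<x\le y$; $G_0(x,y)=\frac{1-(q/(1-q))^y}{1-2q}$ for $x\ge y>0$. 3. $L_0(0,y)=1$ for all $y$, and $L_0(x,y)=\frac{q(\alpha^{x\wedge y}-1)}{1-2q}$ for all $x>0$, $y\ge0$; in particular $D_0(z)<\infty$ for every $z$. 4. There is a unique stationary probability $\beta$, given by $\beta(0)=\frac{1-2q}{2(1-q)}$ and $\beta(x)=\frac{1-2q}{2q(1-q)\alpha^x}$ for $x>0$. 5. For every $w$, the Martin boundary consists of a single point $\infty$, which is also the minimal boundary, and $y\to\infty$ in $\mathbb{N}_0$ implies $y\to\infty$ in the Martin compactification. Each $L_0(x,\cdot)$ extends continuously to the compactification, with $L_0(0,\infty)=1$ and $L_0(x,\infty)=\frac{q(\alpha^x-1)}{1-2q}$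 for $x>0$, and $$\varphi_{0,\infty}(x)=\frac{2q(1-q)}{(1-2q)^2}(\alpha^x-1)\qquad(x\in\mathbb{N}_0).$$ 6. There is exactly one family $(\mathbb{Q}_x^{\infty})_x=(\mathbb{Q}_x^{0,\varphi_{0,\infty}})_x$, and a family $(\mathbb{Q}_x)_x$ of measures is in class $\mathcal{Q}$ if and only if there is $c\ge0$ with $\mathbb{Q}_x=c\,\mathbb{Q}^\infty_x$ for all $x$. -/

import Mathlib

open MeasureTheory ProbabilityTheory Filter Topology
open scoped ENNReal NNReal

namespace MartinQ

noncomputable section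

/-! ### Markov chains on a countable discrete space and their canonical laws

A chain is given by its transition probabilities `p : E → PMF E`, `p x y` being the probability of
a jump from `x` to `y`. The canonical process on `ℕ → E` is `X n ω = ω n`. -/

section Chain

variable {E : Type*} [MeasurableSpace E] [Countable E] [MeasurableSingletonClass E]

/-- The transition kernel of the chain. -/
def stepKernel (p : E → PMF E) : Kernel E E :=
  Kernel.ofFunOfCountable fun x => (p x).toMeasure

instance (p : E → PMF E) : IsMarkovKernel (stepKernel p) :=
  ⟨fun x => PMF.toMeasure.isProbabilityMeasure (p x)⟩

/-- The transition kernel from the history up to time `n` to the state at time `n + 1`; it only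
depends on the state at time `n`. -/
def historyKernel (p : E → PMF E) (n : ℕ) : Kernel ((_ : Finset.Iic n) → E) E :=
  (stepKernel p).comap (fun h => h ⟨n, Finset.mem_Iic.2 le_rfl⟩) (measurable_pi_apply _)

instance (p : E → PMF E) (n : ℕ) : IsMarkovKernel (historyKernel p n) := by
  unfold historyKernel; infer_instance

/-- The law `ℙ_x` on `ℕ → E` of the chain with transition probabilities `p` started at `x`. -/
def law (p : E → PMF E) (x : E) : Measure (ℕ → E) :=
  Kernel.trajMeasure (X := fun _ : ℕ => E) (Measure.dirac x) (historyKernel p)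

/-- `(P x)_x` is the family of laws of a Markov chain with transition probabilities `p`:
`P_x(X_0 = s_0, …, X_k = s_k) = 1_{s_0 = x} p(s_0, s_1) ⋯ p(s_{k-1}, s_k)`. -/
def IsMarkovFamily (p : E → PMF E) (P : E → Measure (ℕ → E)) : Prop :=
  (∀ x, IsProbabilityMeasure (P x)) ∧
  ∀ (x : E) (k : ℕ) (s : ℕ → E),
    P x {ω | ∀ i ≤ k, ω i = s i} =
      {x' | s 0 = x'}.indicator (fun _ => ∏ i ∈ Finset.range k, p (s i) (s (i + 1))) x

def IsIrreducibleChain (p : E → PMF E) : Prop :=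
  ∀ x y, ∃ n : ℕ, 0 < law p x {ω | ω n = y}

def IsRecurrentChain (p : E → PMF E) : Prop :=
  ∀ x, law p x {ω | {n : ℕ | ω n = x}.Infinite} = 1

/-- `b` is a stationary probability distribution of the chain. -/
def IsStationaryDistribution (p : E → PMF E) (b : E → ℝ≥0∞) : Prop :=
  ∑' x, b x = 1 ∧ ∀ y, b y = ∑' x, b x * p x y

/-! ### σ-finite measures attached to a chain -/

/-- The concatenation `(ω_0, …, ω_n, η_1, η_2, …)` of two trajectories. -/
def concat (n : ℕ) (c : (ℕ → E) × (ℕ → E)) : ℕ → E :=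
  fun k => if k ≤ n then c.1 k else c.2 (k - n)

/-- The class `𝒬` of families of σ-finite measures attached to the chain. -/
structure ClassQ (p : E → PMF E) (Q : E → Measure (ℕ → E)) : Prop where
  sigmaFinite : ∀ x, SigmaFinite (Q x)
  /-- `1_{X_n = y} · Q_x = 1_{X_n = y} · (ℙ_x^{(n)} ∘ Q_y)`. -/
  markov : ∀ (n : ℕ) (x y : E),
    (Q x).restrict {ω | ω n = y} =
      (((law p x).prod (Q y)).map (concat n)).restrict {ω | ω n = y}
  avoid_lt_top : ∀ x₀ x : E, Q x {ω | ∀ k, ω k ≠ x₀} < ∞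
  transient : ∀ x₀ x₁ : E, Q x₁ {ω | {k : ℕ | ω k = x₀}.Infinite} = 0

/-- `Q` is the family `(ℚ_x^{x₀, φ})_x`: σ-finite measures under which the canonical process
starts at `x` and is transient, and such that
`ℚ_x^{x₀, φ}(F_n 1_{∀ k ≥ n, X_k ≠ x₀}) = 𝔼_x[F_n φ(X_n)]` for every `n` and every nonnegative
`F_n` that is measurable with respect to `X_0, …, X_n`. -/
structure IsQFamily (p : E → PMF E) (x₀ : E) (φ : E → ℝ≥0∞) (Q : E → Measure (ℕ → E)) :
    Prop where
  sigmaFinite : ∀ x, SigmaFinite (Q x)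
  start : ∀ x, Q x {ω | ω 0 ≠ x} = 0
  transient : ∀ x y, Q x {ω | {n : ℕ | 1 ≤ n ∧ ω n = y}.Infinite} = 0
  lintegral_avoid : ∀ (x : E) (n : ℕ) (F : (ℕ → E) → ℝ≥0∞),
    Measurable[(Filtration.piLE (X := fun _ : ℕ => E)) n] F →
      ∫⁻ ω, {ω | ∀ k ≥ n, ω k ≠ x₀}.indicator F ω ∂(Q x) = ∫⁻ ω, F ω * φ (ω n) ∂(law p x)

/-! ### Martin boundary of a recurrent chain -/

/-- The first strictly positive hitting time `T'_{x₀} = inf {n ≥ 1 : X_n = x₀}`. -/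
def returnTime (x₀ : E) (ω : ℕ → E) : ℕ∞ :=
  ⨅ (n : ℕ) (_ : 1 ≤ n ∧ ω n = x₀), (n : ℕ∞)

/-- The number of visits to `y` at times `0, …, T'_{x₀} - 1`. -/
def visits (x₀ y : E) (ω : ℕ → E) : ℝ≥0∞ :=
  ∑' n : ℕ, {m : ℕ | (m : ℕ∞) < returnTime x₀ ω ∧ ω m = y}.indicator (fun _ => 1) n

/-- The Green function `G_{x₀}` of the chain killed just before its return to `x₀`. -/
def green (p : E → PMF E) (x₀ x y : E) : ℝ≥0∞ :=
  ∫⁻ ω, visits x₀ y ω ∂(law p x)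

/-- `L_{x₀}(x, y) = G_{x₀}(x, y) / G_{x₀}(x₀, y)`. -/
def martinL (p : E → PMF E) (x₀ x y : E) : ℝ≥0∞ :=
  green p x₀ x y / green p x₀ x₀ y

/-- `D_{x₀}(z) = sup_y L_{x₀}(z, y)`. -/
def martinD (p : E → PMF E) (x₀ z : E) : ℝ≥0∞ := ⨆ y, martinL p x₀ z y

/-- The absolute difference `|a - b|` of two elements of `[0, ∞]`. -/
def absDiff (a b : ℝ≥0∞) : ℝ≥0∞ := (a - b) + (b - a)

/-- The indicator `1_{z = x}`. -/
def ind (z x : E) : ℝ≥0∞ := Set.indicator {x} (fun _ => 1) z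

/-- The distance `δ_{x₀, w}` on `E`. -/
def martinDist (p : E → PMF E) (x₀ : E) (w : E → ℝ≥0) (x y : E) : ℝ≥0∞ :=
  ∑' z, (w z : ℝ≥0∞) *
    ((absDiff (martinL p x₀ z x) (martinL p x₀ z y) + absDiff (ind z x) (ind z y)) /
      (martinD p x₀ z + 1))

/-- The set `E`, as a space equipped with the distance `δ_{x₀, w}`. -/
def MartinSpace (_p : E → PMF E) (_x₀ : E) (_w : E → ℝ≥0) : Type _ := E

instance (p : E → PMF E) (x₀ : E) (w : E → ℝ≥0) : PseudoEMetricSpace (MartinSpace p x₀ w) where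
  edist := fun x y => martinDist (E := E) p x₀ w x y
  edist_self x := by simp [martinDist, absDiff]
  edist_comm (x y : E) := by
    simp only [martinDist, absDiff]
    congr 1; funext z
    rw [add_comm (martinL p x₀ z x - _), add_comm (ind z x - _)]
  edist_triangle (x y t : E) := by
    have key : ∀ a b c : ℝ≥0∞, absDiff a c ≤ absDiff a b + absDiff b c := by
      intro a b c
      unfold absDiff
      calc (a - c) + (c - a) ≤ ((a - b) + (b - c)) + ((c - b) + (b - a)) :=
            add_le_add tsub_le_tsub_add_tsub tsub_le_tsub_add_tsub
        _ = _ := by ring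
    simp only [martinDist]
    rw [← ENNReal.tsum_add]
    refine ENNReal.tsum_le_tsum fun z => ?_
    rw [← mul_add, ← ENNReal.add_div, add_add_add_comm]
    exact mul_le_mul_right
      (ENNReal.div_le_div_right (add_le_add (key _ _ _) (key _ _ _)) _) _

/-- The Martin compactification: the completion of `(E, δ_{x₀, w})`. -/
abbrev MartinCompactification (p : E → PMF E) (x₀ : E) (w : E → ℝ≥0) : Type _ :=
  UniformSpace.Completion (MartinSpace p x₀ w)

/-- The canonical map from `E` to its Martin compactification. -/
def toMartin (p : E → PMF E) (x₀ : E) (w : E → ℝ≥0) (x : E) : MartinCompactification p x₀ w :=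
  UniformSpace.Completion.coe' (α := MartinSpace p x₀ w) x

/-- The Martin boundary: what the completion adds to `E`. -/
def martinBoundary (p : E → PMF E) (x₀ : E) (w : E → ℝ≥0) : Set (MartinCompactification p x₀ w) :=
  (Set.range (toMartin p x₀ w))ᶜ

/-- The extension of `L_{x₀}(x, ·)` to the Martin compactification by continuity. -/
def martinLExt (p : E → PMF E) (x₀ : E) (w : E → ℝ≥0) (x : E) :
    MartinCompactification p x₀ w → ℝ≥0∞ :=
  (UniformSpace.Completion.isDenseInducing_coe (α := MartinSpace p x₀ w)).extend
    (fun y => martinL p x₀ x y)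

/-- Finite nonnegative functions that are harmonic for the transitions `p(x, y) 1_{y ≠ x₀}` of the
killed chain. -/
def IsKilledHarmonic (p : E → PMF E) (x₀ : E) (h : E → ℝ≥0∞) : Prop :=
  (∀ x, h x < ∞) ∧ ∀ x, h x = ∑' y, ({x₀}ᶜ : Set E).indicator (fun y => p x y * h y) y

/-- Minimal harmonic functions for the killed chain. -/
def IsMinimalKilledHarmonic (p : E → PMF E) (x₀ : E) (h : E → ℝ≥0∞) : Prop :=
  IsKilledHarmonic p x₀ h ∧
  ∀ ψ : E → ℝ≥0∞, IsKilledHarmonic p x₀ ψ → (∀ x, ψ x ≤ h x) →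
    ∃ c : ℝ≥0, c ≤ 1 ∧ ∀ x, ψ x = c * h x

/-- The minimal boundary. -/
def minimalBoundary (p : E → PMF E) (x₀ : E) (w : E → ℝ≥0) :
    Set (MartinCompactification p x₀ w) :=
  {a ∈ martinBoundary p x₀ w | IsMinimalKilledHarmonic p x₀ fun x => martinLExt p x₀ w x a}

/-- `φ_{x₀, a}(x) = (L_{x₀}(x, a) / β(x₀)) 1_{x ≠ x₀}`. -/
def martinPhi (p : E → PMF E) (x₀ : E) (w : E → ℝ≥0) (β : E → ℝ≥0∞)
    (a : MartinCompactification p x₀ w) (x : E) : ℝ≥0∞ :=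
  ({x₀}ᶜ : Set E).indicator (fun x => martinLExt p x₀ w x a / β x₀) x

end Chain

/-! ### The bang-bang random walk -/

/-- Transition probabilities of the bang-bang random walk on `ℕ`. -/
def bangBangProb (q : ℝ) (x y : ℕ) : ℝ :=
  if x = 0 then (if y = 1 then 1 else 0)
  else if y = x + 1 then q
  else if y + 1 = x then 1 - q
  else 0

/-- The bang-bang random walk: `p(0,1) = 1` and, for `y ≥ 1`, `p(y,y+1) = q`, `p(y,y-1) = 1 - q`. -/
def bangBang (q : ℝ) (h0 : 0 ≤ q) (h1 : q ≤ 1) (x : ℕ) : PMF ℕ :=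
  ⟨fun y => ENNReal.ofReal (bangBangProb q x y), by
    rcases x with _ | x
    · have h : (fun y => ENNReal.ofReal (bangBangProb q 0 y)) =
          fun y => if y = 1 then (1 : ℝ≥0∞) else 0 := by
        funext y
        by_cases hy : y = 1 <;> simp [bangBangProb, hy]
      rw [h]
      exact hasSum_ite_eq 1 1
    · have h : (fun y => ENNReal.ofReal (bangBangProb q (x + 1) y)) =
          fun y => (if y = x + 2 then ENNReal.ofReal q else 0) +
            (if y = x then ENNReal.ofReal (1 - q) else 0) := by
        funext y
        by_cases hy : y = x + 2
        · simp [bangBangProb, hy]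
        · by_cases hy' : y = x
          · subst hy'
            have h2 : y ≠ y + 1 + 1 := by omega
            simp [bangBangProb, h2]
          · simp [bangBangProb, hy, hy']
      rw [h]
      have := (hasSum_ite_eq (x + 2) (ENNReal.ofReal q)).add
        (hasSum_ite_eq x (ENNReal.ofReal (1 - q)))
      rwa [← ENNReal.ofReal_add h0 (by linarith), add_sub_cancel, ENNReal.ofReal_one] at this⟩

end

end MartinQ

open MartinQ

/-! Everything rests on one second-order recurrence. A function harmonic for the chain killed at
`0`, once set to `0` at `0`, solves `h (x+1) = q h (x+2) + (1-q) h x` with `h 0 = 0`. The solutions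
are the multiples of `harm` (`eq_mul_harm`), and `harm q x ≥ x`, so the only bounded nonnegative
solution is zero (`eq_zero_of_bounded`).

Boundedness gives recurrence, since the probability of never hitting a state is such a solution
above that state. It also identifies the Green function: `green` is the least solution of its
recursion, so any bounded candidate equals it. The candidate for `y > 0` follows `limitL` up to `y`
and is constant beyond, so `martinL` at `(x, y)` depends only on `x` and `min x y`. It is therefore
constant in `y` from `x` on. Hence the integers form a Cauchy sequence for the Martin distance,
while the indicator terms isolate each of them: the completion adds one point, where the kernel is
`limitL`. One-dimensionality of the harmonic functions makes that kernel minimal.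

For the measures, existence comes from a last-exit decomposition: run the chain to its last visit to
`x₀`, then follow Doob's transform by a positive killed-harmonic function, which never returns to
`x₀` (`lastExit_cyl`). Finiteness of the Green function makes the transform transient. Uniqueness
holds because the events `cyl n s ∩ avoid x₀ n` determine a measure under which `x₀` is transient
(`ext_of_cyl_inter_avoid`).

A family in class `𝒬` is the family attached to `ψ x = Q x (avoid x₀ 0)`, and `ψ` vanishes at `x₀`
and is harmonic elsewhere; so `ψ`, and with it `Q`, is fixed up to a constant (`classQ_iff`).
Conversely, unit steps and transience force a path that avoids some state to avoid `0` as well,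
which gives the required finiteness. -/

namespace MartinQ

/-! ### Cylinder sets and the measures they determine. -/

section Cylinders

variable {E : Type*}

/-- The trajectories that agree with `s` up to time `n`. -/
def cyl (n : ℕ) (s : ℕ → E) : Set (ℕ → E) := {ω | ∀ i ≤ n, ω i = s i}

/-- The trajectories that avoid `x₀` from time `n` on. -/
def avoid (x₀ : E) (n : ℕ) : Set (ℕ → E) := {ω | ∀ k ≥ n, ω k ≠ x₀}

theorem cyl_congr {n : ℕ} {s t : ℕ → E} (h : ∀ i ≤ n, s i = t i) : cyl n s = cyl n t := by
  ext ω
  exact forall₂_congr fun i hi => by rw [h i hi]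

theorem cyl_succ (n : ℕ) (s : ℕ → E) :
    cyl (n + 1) s = cyl n s ∩ {ω | ω (n + 1) = s (n + 1)} := by
  ext ω
  constructor
  · exact fun h => ⟨fun i hi => h i (by omega), h _ le_rfl⟩
  · rintro ⟨h, h'⟩ i hi
    rcases Nat.lt_or_ge n i with hn | hn
    · obtain rfl : i = n + 1 := by omega
      exact h'
    · exact h i hn

theorem cyl_inter_cyl {m n : ℕ} (hmn : m ≤ n) {s t ω : ℕ → E} (h : ω ∈ cyl m s ∩ cyl n t) :
    cyl m s ∩ cyl n t = cyl n t := by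
  refine Set.inter_eq_right.2 fun η hη i hi => ?_
  rw [hη i (hi.trans hmn), ← h.2 i (hi.trans hmn), h.1 i hi]

theorem countable_range_cyl [Countable E] (n : ℕ) : (Set.range (cyl (E := E) n)).Countable := by
  refine (Set.countable_range fun v : Fin (n + 1) → E => {ω : ℕ → E | ∀ i, ω i.1 = v i}).mono ?_
  rintro _ ⟨s, rfl⟩
  refine ⟨fun i => s i, ?_⟩
  ext ω
  exact ⟨fun h i hi => h ⟨i, by omega⟩, fun h i => h i (by omega)⟩

theorem avoid_mono (x₀ : E) : Monotone (avoid x₀) := fun _ _ h _ hω k hk => hω k (h.trans hk)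

/-- The events `avoid x₀ n` increase with `n`, so dropping finitely many of them changes nothing;
the free bound `N` allows identities to be checked only at late times. -/
theorem avoid_eq_compl_infinite (x₀ : E) (N : ℕ) :
    ⋃ n ≥ N, avoid x₀ n = {ω : ℕ → E | {n | ω n = x₀}.Infinite}ᶜ := by
  ext ω
  simp only [Set.mem_iUnion, Set.mem_compl_iff, Set.mem_ofPred_eq, Set.not_infinite]
  constructor
  · rintro ⟨n, -, h⟩
    refine (Set.finite_lt_nat n).subset fun k hk => ?_
    by_contra hc
    exact h k (not_lt.1 hc) hk
  · intro h
    obtain ⟨n, hn⟩ := h.bddAbove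
    refine ⟨max N (n + 1), le_max_left _ _, fun k hk hk' => ?_⟩
    have := hn hk'
    have := le_max_right N (n + 1)
    omega

/-- All cylinder sets. -/
def cylinderSets (E : Type*) : Set (Set (ℕ → E)) := ⋃ n, Set.range (cyl n)

theorem isPiSystem_cylinderSets : IsPiSystem (cylinderSets E) := by
  intro A hA B hB hAB
  obtain ⟨m, s, rfl⟩ := Set.mem_iUnion.1 hA
  obtain ⟨n, t, rfl⟩ := Set.mem_iUnion.1 hB
  obtain ⟨ω, hω⟩ := hAB
  rcases le_total m n with h | h
  · rwa [cyl_inter_cyl h hω]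
  · rw [Set.inter_comm] at hω ⊢
    rwa [cyl_inter_cyl h hω]

variable [MeasurableSpace E] [MeasurableSingletonClass E]

theorem measurableSet_eval_eq (n : ℕ) (x : E) : MeasurableSet {ω : ℕ → E | ω n = x} :=
  (measurableSet_singleton x).preimage (measurable_pi_apply (X := fun _ : ℕ => E) n)

theorem measurableSet_cyl (n : ℕ) (s : ℕ → E) : MeasurableSet (cyl n s) := by
  have : cyl n s = ⋂ i, ⋂ (_ : i ≤ n), {ω | ω i = s i} := by ext; simp [cyl]
  rw [this]
  exact .iInter fun i => .iInter fun _ => measurableSet_eval_eq _ _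

theorem measurableSet_avoid (x₀ : E) (n : ℕ) : MeasurableSet (avoid x₀ n) := by
  have : avoid x₀ n = ⋂ i, ⋂ (_ : n ≤ i), {ω | ω i = x₀}ᶜ := by ext; simp [avoid]
  rw [this]
  exact .iInter fun i => .iInter fun _ => (measurableSet_eval_eq _ _).compl

theorem measurableSet_infinite (x₀ : E) :
    MeasurableSet {ω : ℕ → E | {n | ω n = x₀}.Infinite} := by
  rw [← MeasurableSet.compl_iff, ← avoid_eq_compl_infinite x₀ 0]
  exact .iUnion fun n => .iUnion fun _ => measurableSet_avoid _ _

variable [Countable E]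

theorem generateFrom_cylinderSets :
    (MeasurableSpace.pi : MeasurableSpace (ℕ → E)) =
      MeasurableSpace.generateFrom (cylinderSets E) := by
  apply le_antisymm
  · refine iSup_le fun k => ?_
    rintro _ ⟨S, -, rfl⟩
    have : (fun ω : ℕ → E => ω k) ⁻¹' S = ⋃₀ {A ∈ Set.range (cyl k) | ∀ ω ∈ A, ω k ∈ S} := by
      ext ω
      constructor
      · intro h
        refine ⟨cyl k ω, ⟨⟨ω, rfl⟩, fun η hη => ?_⟩, fun _ _ => rfl⟩
        rw [hη k le_rfl]
        exact h
      · rintro ⟨A, ⟨-, hA⟩, hω⟩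
        exact hA ω hω
    rw [this]
    refine MeasurableSet.sUnion ((countable_range_cyl k).mono (Set.sep_subset _ _)) ?_
    rintro A ⟨hA, -⟩
    exact MeasurableSpace.measurableSet_generateFrom (Set.mem_iUnion.2 ⟨k, hA⟩)
  · refine MeasurableSpace.generateFrom_le fun A hA => ?_
    obtain ⟨n, s, rfl⟩ := Set.mem_iUnion.1 hA
    exact measurableSet_cyl n s

theorem ext_of_cyl {μ ν : Measure (ℕ → E)} [IsProbabilityMeasure μ] [IsProbabilityMeasure ν]
    (h : ∀ n s, μ (cyl n s) = ν (cyl n s)) : μ = ν := by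
  refine ext_of_generate_finite _ generateFrom_cylinderSets isPiSystem_cylinderSets ?_ (by simp)
  intro A hA
  obtain ⟨n, s, rfl⟩ := Set.mem_iUnion.1 hA
  exact h n s

/-- Two measures under which `x₀` is transient agree if they agree on the events
`X_0 = s_0, …, X_n = s_n, X_k ≠ x₀ for k ≥ n`. -/
theorem ext_of_cyl_inter_avoid {μ ν : Measure (ℕ → E)} (x₀ : E) (N : ℕ)
    (hμ : μ {ω | {n | ω n = x₀}.Infinite} = 0) (hν : ν {ω | {n | ω n = x₀}.Infinite} = 0)
    (hfin : ∀ n ≥ N, ∀ s, μ (cyl n s ∩ avoid x₀ n) ≠ ∞)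
    (h : ∀ n ≥ N, ∀ s, μ (cyl n s ∩ avoid x₀ n) = ν (cyl n s ∩ avoid x₀ n)) : μ = ν := by
  set Z : Set (ℕ → E) := {ω | {n | ω n = x₀}.Infinite}
  have key : ∀ n ≥ N, ∀ s, ∀ m t, μ (cyl m t ∩ (cyl n s ∩ avoid x₀ n)) =
      ν (cyl m t ∩ (cyl n s ∩ avoid x₀ n)) := by
    intro n hn s m t
    rw [← Set.inter_assoc]
    rcases (cyl m t ∩ cyl n s).eq_empty_or_nonempty with he | ⟨ω, hω⟩
    · simp [he]
    rcases le_total m n with hmn | hmn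
    · rw [cyl_inter_cyl hmn hω]
      exact h n hn s
    rw [Set.inter_comm (cyl m t)] at hω ⊢
    rw [cyl_inter_cyl hmn hω]
    -- On the longer cylinder, avoidance between times `n` and `m` is decided by `t`: the event is
    -- either one of the test events at time `m` or empty.
    by_cases ht : ∀ k, n ≤ k → k ≤ m → t k ≠ x₀
    · have : cyl m t ∩ avoid x₀ n = cyl m t ∩ avoid x₀ m := by
        ext η
        refine and_congr_right fun hη => ⟨fun h' => avoid_mono x₀ hmn h', fun h' k hk => ?_⟩
        rcases le_total k m with hkm | hkm
        · rw [hη k hkm]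
          exact ht k hk hkm
        · exact h' k hkm
      rw [this]
      exact h m (hn.le.trans hmn) t
    · push Not at ht
      obtain ⟨k, hk, hkm, hkt⟩ := ht
      have : cyl m t ∩ avoid x₀ n = ∅ := by
        ext η
        simp only [Set.mem_inter_iff, Set.mem_empty_iff_false, iff_false, not_and]
        exact fun hη h' => h' k hk ((hη k hkm).trans hkt)
      simp [this]
  -- The countable cover consists of the null set of trajectories visiting `x₀` infinitely often and
  -- of the test events, which have finite mass.
  refine Measure.ext_of_generateFrom_of_cover (S := cylinderSets E)
    (T := {Z} ∪ ⋃ n, ⋃ (_ : N ≤ n), (· ∩ avoid x₀ n) '' Set.range (cyl n))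
    generateFrom_cylinderSets ?_ isPiSystem_cylinderSets ?_ ?_ ?_ ?_
  · exact (Set.countable_singleton _).union (Set.countable_iUnion fun n =>
      Set.countable_iUnion fun _ => (countable_range_cyl n).image _)
  · refine Set.eq_univ_of_forall fun ω => ?_
    by_cases hω : ω ∈ Z
    · exact ⟨Z, Or.inl rfl, hω⟩
    · have : ω ∈ Zᶜ := hω
      rw [← avoid_eq_compl_infinite x₀ N] at this
      simp only [Set.mem_iUnion] at this
      obtain ⟨n, hn, hω⟩ := this
      refine ⟨cyl n ω ∩ avoid x₀ n, Or.inr ?_, fun _ _ => rfl, hω⟩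
      simp only [Set.mem_iUnion]
      exact ⟨n, hn, _, ⟨ω, rfl⟩, rfl⟩
  · rintro A (rfl | hA)
    · simp [hμ]
    · simp only [Set.mem_iUnion] at hA
      obtain ⟨n, hn, _, ⟨s, rfl⟩, rfl⟩ := hA
      exact hfin n hn s
  · rintro A (rfl | hA) B hB
    · rw [measure_mono_null Set.inter_subset_right hμ, measure_mono_null Set.inter_subset_right hν]
    · simp only [Set.mem_iUnion] at hA
      obtain ⟨n, hn, _, ⟨s, rfl⟩, rfl⟩ := hA
      obtain ⟨m, t, rfl⟩ := Set.mem_iUnion.1 hB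
      exact key n hn s m t
  · rintro A (rfl | hA)
    · rw [hμ, hν]
    · simp only [Set.mem_iUnion] at hA
      obtain ⟨n, hn, _, ⟨s, rfl⟩, rfl⟩ := hA
      exact h n hn s

/-- Two measures that agree on the cylinders of length `n` integrate functions of
`X_0, …, X_n` in the same way. -/
theorem lintegral_eq_of_cyl {μ ν : Measure (ℕ → E)} {n : ℕ}
    (h : ∀ s, μ (cyl n s) = ν (cyl n s)) {F : (ℕ → E) → ℝ≥0∞}
    (hF : Measurable[(Filtration.piLE (X := fun _ : ℕ => E)) n] F) :
    ∫⁻ ω, F ω ∂μ = ∫⁻ ω, F ω ∂ν := by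
  rw [Filtration.piLE_eq_comap_frestrictLe] at hF
  obtain ⟨G, hG, rfl⟩ := hF.exists_eq_measurable_comp
  have hm : Measurable (Preorder.frestrictLe (π := fun _ : ℕ => E) n) :=
    Preorder.measurable_frestrictLe n
  change ∫⁻ ω, G (Preorder.frestrictLe n ω) ∂μ = ∫⁻ ω, G (Preorder.frestrictLe n ω) ∂ν
  rw [← lintegral_map hG hm, ← lintegral_map hG hm]
  congr 1
  refine Measure.ext_of_singleton fun v => ?_
  rw [Measure.map_apply hm (measurableSet_singleton v),
    Measure.map_apply hm (measurableSet_singleton v)]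
  rcases (Preorder.frestrictLe (π := fun _ : ℕ => E) n ⁻¹' {v}).eq_empty_or_nonempty with he | ⟨s, hs⟩
  · simp [he]
  · have : Preorder.frestrictLe (π := fun _ : ℕ => E) n ⁻¹' {v} = cyl n s := by
      obtain rfl : Preorder.frestrictLe (π := fun _ : ℕ => E) n s = v := hs
      ext ω
      simp only [Set.mem_preimage, Set.mem_singleton_iff, funext_iff]
      exact ⟨fun h i hi => h ⟨i, Finset.mem_Iic.2 hi⟩, fun h i => h i (Finset.mem_Iic.1 i.2)⟩
    rw [this, h]

end Cylinders

/-! ### Cylinder probabilities and the Markov property of `law`. -/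

section Law

/-- The trajectory `(x, ω_0, ω_1, …)`. -/
def cons {E : Type*} (x : E) (ω : ℕ → E) : ℕ → E := fun n => n.casesOn x ω

theorem measurable_cons {E : Type*} [MeasurableSpace E] (x : E) : Measurable (cons x) := by
  refine measurable_pi_lambda _ fun n => ?_
  cases n with
  | zero => exact measurable_const
  | succ n => exact measurable_pi_apply n

variable {E : Type*} [MeasurableSpace E] [Countable E] [MeasurableSingletonClass E]

instance isProbabilityMeasure_law (p : E → PMF E) (x : E) : IsProbabilityMeasure (law p x) := by
  unfold law; infer_instance

theorem law_start (p : E → PMF E) (x : E) : law p x {ω | ω 0 ≠ x} = 0 := by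
  have h : (law p x).map (Preorder.frestrictLe 0) =
      (Measure.dirac x).map (MeasurableEquiv.piUnique fun _ : Finset.Iic 0 => E).symm := by
    rw [law, Kernel.trajMeasure, Measure.map_comp _ _ (by fun_prop), Kernel.traj_map_frestrictLe,
      Kernel.partialTraj_self, Measure.id_comp]
  have hS : MeasurableSet {v : (Finset.Iic 0) → E | v ⟨0, by simp⟩ ≠ x} :=
    ((measurableSet_singleton x).preimage
      (measurable_pi_apply (X := fun _ : Finset.Iic 0 => E) _)).compl
  have := congrArg (fun μ => μ {v | v ⟨0, by simp⟩ ≠ x}) h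
  rw [Measure.map_apply (by fun_prop) hS, Measure.map_apply (by fun_prop) hS] at this
  refine Eq.trans ?_ (this.trans ?_)
  · rfl
  · rw [Measure.dirac_apply' _ (MeasurableEquiv.measurable _ hS)]
    simp [MeasurableEquiv.piUnique]

theorem law_cyl_of_ne (p : E → PMF E) {x : E} {s : ℕ → E} (h : s 0 ≠ x) (n : ℕ) :
    law p x (cyl n s) = 0 :=
  measure_mono_null (fun _ hω h' => h ((hω 0 zero_le).symm.trans h')) (law_start p x)

theorem law_cyl_zero (p : E → PMF E) (s : ℕ → E) : law p (s 0) (cyl 0 s) = 1 := by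
  have := prob_compl_eq_zero_iff (μ := law p (s 0)) (measurableSet_cyl 0 s)
  rw [← this]
  refine measure_mono_null (fun ω hω => ?_) (law_start p (s 0))
  contrapose! hω
  simpa [cyl] using hω

/-- The joint law of the history and the next state is a composition-product; this is its value on a
rectangle of singletons. -/
theorem law_cyl_succ (p : E → PMF E) (x : E) (n : ℕ) (s : ℕ → E) :
    law p x (cyl (n + 1) s) = law p x (cyl n s) * p (s n) (s (n + 1)) := by
  have h := Kernel.map_frestrictLe_trajMeasure_compProd_eq_map_trajMeasure
    (X := fun _ : ℕ => E) (μ₀ := Measure.dirac x) (κ := historyKernel p) (a := n)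
  set v : (Finset.Iic n) → E := Preorder.frestrictLe (π := fun _ : ℕ => E) n s
  have hm : Measurable (Preorder.frestrictLe (π := fun _ : ℕ => E) n) :=
    Preorder.measurable_frestrictLe n
  have hpre : Preorder.frestrictLe (π := fun _ : ℕ => E) n ⁻¹' {v} = cyl n s := by
    ext ω
    simp only [Set.mem_preimage, Set.mem_singleton_iff, funext_iff, v]
    exact ⟨fun h i hi => h ⟨i, Finset.mem_Iic.2 hi⟩, fun h i => h i (Finset.mem_Iic.1 i.2)⟩
  have h' := congrArg (fun μ => μ ({v} ×ˢ {s (n + 1)})) h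
  rw [Measure.map_apply (by fun_prop)
    ((measurableSet_singleton v).prod (measurableSet_singleton _)),
    Measure.compProd_apply_prod (measurableSet_singleton v) (measurableSet_singleton _),
    Measure.restrict_singleton, lintegral_smul_measure, lintegral_dirac,
    Measure.map_apply hm (measurableSet_singleton v), hpre] at h'
  have e : (fun x : ℕ → E => (Preorder.frestrictLe n x, x (n + 1))) ⁻¹' ({v} ×ˢ {s (n + 1)}) =
      cyl (n + 1) s := by
    rw [cyl_succ, ← hpre]
    rfl
  rw [e] at h'
  refine h'.symm.trans ?_
  rw [smul_eq_mul]
  congr 1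
  rw [historyKernel, Kernel.comap_apply]
  exact PMF.toMeasure_apply_singleton _ _ (measurableSet_singleton _)

theorem law_cyl (p : E → PMF E) (n : ℕ) (s : ℕ → E) :
    law p (s 0) (cyl n s) = ∏ i ∈ Finset.range n, p (s i) (s (i + 1)) := by
  induction n with
  | zero => simp [law_cyl_zero]
  | succ n ih => rw [law_cyl_succ, ih, Finset.prod_range_succ]

theorem isMarkovFamily_law (p : E → PMF E) : IsMarkovFamily p (law p) := by
  refine ⟨fun x => inferInstance, fun x k s => ?_⟩
  by_cases h : s 0 = x
  · subst h
    rw [Set.indicator_of_mem (by simp)]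
    exact law_cyl p k s
  · rw [Set.indicator_of_notMem (by exact h)]
    exact law_cyl_of_ne p h k

theorem law_cyl_add (p : E → PMF E) (x : E) (n m : ℕ) (s : ℕ → E) :
    law p x (cyl (n + m) s) = law p x (cyl n s) * law p (s n) (cyl m fun i => s (n + i)) := by
  induction m with
  | zero => rw [show law p (s n) _ = 1 from law_cyl_zero p fun i => s (n + i), mul_one, add_zero]
  | succ m ih => rw [← add_assoc, law_cyl_succ, ih, law_cyl_succ, mul_assoc, add_assoc]

/-- Conditioning on the first step. Both sides are probability measures, and on a cylinder only the
term `z = s 1` survives. -/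
theorem law_eq_sum (p : E → PMF E) (x : E) :
    law p x = Measure.sum fun z => p x z • (law p z).map (cons x) := by
  have hP : IsProbabilityMeasure (Measure.sum fun z => p x z • (law p z).map (cons x)) := by
    have := fun z => Measure.isProbabilityMeasure_map (μ := law p z) (measurable_cons x).aemeasurable
    constructor
    rw [Measure.sum_apply _ .univ]
    simp [(p x).tsum_coe]
  refine ext_of_cyl fun n s => ?_
  rw [Measure.sum_apply _ (measurableSet_cyl n s)]
  simp only [Measure.smul_apply, smul_eq_mul,
    Measure.map_apply (measurable_cons x) (measurableSet_cyl n s)]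
  by_cases hs : s 0 = x
  · subst hs
    cases n with
    | zero =>
      have : cons (s 0) ⁻¹' cyl 0 s = Set.univ := by
        ext ω; simp [cyl, cons]
      simp [this, law_cyl_zero, (p (s 0)).tsum_coe]
    | succ n =>
      have : cons (s 0) ⁻¹' cyl (n + 1) s = cyl n fun i => s (i + 1) := by
        ext ω
        refine ⟨fun h i hi => h (i + 1) (by omega), fun h i hi => ?_⟩
        cases i with
        | zero => rfl
        | succ i => exact h i (by omega)
      rw [this, tsum_eq_single (s 1), add_comm n 1, law_cyl_add, law_cyl_succ, law_cyl_zero, one_mul]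
      · simp only [add_comm 1]
      · intro z hz
        rw [law_cyl_of_ne p (fun h => hz h.symm), mul_zero]
  · have : cons x ⁻¹' cyl n s = ∅ := by
      ext ω
      simp only [Set.mem_preimage, Set.mem_empty_iff_false, iff_false]
      exact fun h => hs (h 0 zero_le).symm
    simp [this, law_cyl_of_ne p hs]

/-- The Markov property at time `1`. -/
theorem lintegral_law (p : E → PMF E) (x : E) {f : (ℕ → E) → ℝ≥0∞} (hf : Measurable f) :
    ∫⁻ ω, f ω ∂(law p x) = ∑' z, p x z * ∫⁻ ω, f (cons x ω) ∂(law p z) := by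
  conv_lhs => rw [law_eq_sum]
  rw [lintegral_sum_measure]
  simp_rw [lintegral_smul_measure, smul_eq_mul, lintegral_map hf (measurable_cons x)]

theorem law_apply (p : E → PMF E) (x : E) {A : Set (ℕ → E)} (hA : MeasurableSet A) :
    law p x A = ∑' z, p x z * law p z (cons x ⁻¹' A) := by
  conv_lhs => rw [law_eq_sum]
  rw [Measure.sum_apply _ hA]
  simp_rw [Measure.smul_apply, smul_eq_mul, Measure.map_apply (measurable_cons x) hA]

end Law

/-! ### Null sets of trajectories. -/

section Null

variable {E : Type*}

theorem infinite_one_le_iff (y : E) (ω : ℕ → E) :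
    {n : ℕ | 1 ≤ n ∧ ω n = y}.Infinite ↔ {n | ω n = y}.Infinite := by
  refine ⟨fun h => h.mono fun n hn => hn.2, fun h => ?_⟩
  refine (h.sdiff (Set.finite_singleton 0)).mono fun n hn => ⟨?_, hn.1⟩
  exact Nat.one_le_iff_ne_zero.2 hn.2

/-- There are countably many cylinders of each length, so nullity can be tested prefix by prefix;
`A` need not be measurable. -/
theorem null_of_cyl [Countable E] [MeasurableSpace E] {μ : Measure (ℕ → E)} (n : ℕ)
    {A : Set (ℕ → E)} (h : ∀ ω ∈ A, μ (cyl n ω ∩ A) = 0) : μ A = 0 := by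
  refine measure_mono_null (t := ⋃₀ ((· ∩ A) '' {C ∈ Set.range (cyl n) | (C ∩ A).Nonempty})) ?_ ?_
  · intro ω hω
    have hm : ω ∈ cyl n ω := fun _ _ => rfl
    exact ⟨_, ⟨_, ⟨⟨ω, rfl⟩, ω, hm, hω⟩, rfl⟩, hm, hω⟩
  · refine measure_sUnion_null_iff (((countable_range_cyl n).mono (Set.sep_subset _ _)).image _) |>.2 ?_
    rintro _ ⟨_, ⟨⟨s, rfl⟩, ω, hω, hA⟩, rfl⟩
    have := h ω hA
    rwa [cyl_congr hω] at this

end Null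

/-! ### The chain killed at `x₀`, its Green function and Doob's transform. -/

section Killed

variable {E : Type*} [MeasurableSpace E] [Countable E] [MeasurableSingletonClass E]

theorem law_congr (p : E → PMF E) (x : E) {A B : Set (ℕ → E)}
    (h : ∀ ω, ω 0 = x → (ω ∈ A ↔ ω ∈ B)) : law p x A = law p x B := by
  refine measure_congr ?_
  have : ∀ᵐ ω ∂(law p x), ω 0 = x := law_start p x
  filter_upwards [this] with ω hω
  exact propext (h ω hω)

/-- The transition operator of the chain killed at `x₀`. -/
noncomputable def killedStep {E : Type*} (p : E → PMF E) (x₀ : E) (f : E → ℝ≥0∞) (x : E) : ℝ≥0∞ :=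
  ∑' z, ({x₀}ᶜ : Set E).indicator (fun z => p x z * f z) z

theorem killedStep_mono {E : Type*} (p : E → PMF E) (x₀ : E) {f g : E → ℝ≥0∞} (h : ∀ x, f x ≤ g x)
    (x : E) : killedStep p x₀ f x ≤ killedStep p x₀ g x :=
  ENNReal.tsum_le_tsum fun z => Set.indicator_le_indicator (by gcongr; exact h z)

theorem lt_returnTime_iff {E : Type*} (x₀ : E) (ω : ℕ → E) (m : ℕ) :
    (m : ℕ∞) < returnTime x₀ ω ↔ ∀ i, 1 ≤ i → i ≤ m → ω i ≠ x₀ := by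
  rw [← not_le, returnTime]
  constructor
  · intro h i hi him hx
    exact h ((iInf₂_le i ⟨hi, hx⟩).trans (by exact_mod_cast him))
  · intro h hle
    have : ((m + 1 : ℕ) : ℕ∞) ≤ ⨅ (n : ℕ) (_ : 1 ≤ n ∧ ω n = x₀), (n : ℕ∞) := by
      refine le_iInf₂ fun n hn => ?_
      by_contra hc
      exact h n hn.1 (by have := not_le.1 hc; norm_cast at this; omega) hn.2
    have := this.trans hle
    norm_cast at this
    omega

/-- The event that the chain is at `y` at time `n` without having returned to `x₀`. -/
def killedVisit {E : Type*} (x₀ y : E) (n : ℕ) : Set (ℕ → E) :=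
  {ω | (∀ i, 1 ≤ i → i ≤ n → ω i ≠ x₀) ∧ ω n = y}

theorem measurableSet_killedVisit {E : Type*} [MeasurableSpace E] [MeasurableSingletonClass E]
    (x₀ y : E) (n : ℕ) : MeasurableSet (killedVisit x₀ y n) := by
  have : killedVisit x₀ y n =
      (⋂ i, ⋂ (_ : 1 ≤ i), ⋂ (_ : i ≤ n), {ω | ω i = x₀}ᶜ) ∩ {ω | ω n = y} := by
    ext; simp [killedVisit]
  rw [this]
  exact (MeasurableSet.iInter fun i => .iInter fun _ => .iInter fun _ =>
    (measurableSet_eval_eq _ _).compl).inter (measurableSet_eval_eq _ _)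

theorem law_killedVisit (p : E → PMF E) (x₀ y : E) (n : ℕ) (x : E) :
    law p x (killedVisit x₀ y n) = (killedStep p x₀)^[n] (Set.indicator {y} 1) x := by
  induction n generalizing x with
  | zero =>
    by_cases hx : x = y
    · subst hx
      rw [law_congr p x (B := Set.univ)]
      · simp
      · intro ω hω
        refine ⟨fun _ => trivial, fun _ => ⟨fun i hi hi' => by omega, hω⟩⟩
    · rw [law_congr p x (B := ∅)]
      · simp [hx]
      · intro ω hω
        refine ⟨fun h => hx (hω.symm.trans h.2), fun h => h.elim⟩
  | succ n ih =>
    rw [Function.iterate_succ_apply', law_apply p x (measurableSet_killedVisit x₀ y _)]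
    refine tsum_congr fun z => ?_
    by_cases hz : z = x₀
    · subst hz
      rw [Set.indicator_of_notMem (by simp), law_congr p z (B := ∅)]
      · simp
      · intro ω hω
        refine ⟨fun h => h.1 1 le_rfl (by omega) hω, fun h => h.elim⟩
    · rw [Set.indicator_of_mem (by simpa using hz), ← ih, law_congr p z]
      intro ω hω
      constructor
      · exact fun h => ⟨fun i hi hin => h.1 (i + 1) (by omega) (by omega), h.2⟩
      · refine fun h => ⟨fun i hi hin => ?_, h.2⟩
        obtain ⟨i, rfl⟩ : ∃ j, i = j + 1 := ⟨i - 1, by omega⟩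
        rcases Nat.eq_zero_or_pos i with rfl | hi'
        · exact fun h' => hz (hω.symm.trans h')
        · exact h.1 i hi' (by omega)

theorem green_eq_tsum (p : E → PMF E) (x₀ x y : E) :
    green p x₀ x y = ∑' n, (killedStep p x₀)^[n] (Set.indicator {y} 1) x := by
  have h : ∀ ω n, {m : ℕ | (m : ℕ∞) < returnTime x₀ ω ∧ ω m = y}.indicator
      (fun _ => (1 : ℝ≥0∞)) n = (killedVisit x₀ y n).indicator 1 ω := by
    intro ω n
    have : n ∈ {m : ℕ | (m : ℕ∞) < returnTime x₀ ω ∧ ω m = y} ↔ ω ∈ killedVisit x₀ y n :=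
      and_congr_left' (lt_returnTime_iff x₀ ω n)
    by_cases h : ω ∈ killedVisit x₀ y n
    · rw [Set.indicator_of_mem (this.2 h), Set.indicator_of_mem h, Pi.one_apply]
    · rw [Set.indicator_of_notMem (mt this.1 h), Set.indicator_of_notMem h]
  simp_rw [green, visits, h]
  rw [lintegral_tsum fun n =>
    (measurable_one.indicator (measurableSet_killedVisit x₀ y n)).aemeasurable]
  refine tsum_congr fun n => ?_
  rw [lintegral_indicator_one (measurableSet_killedVisit x₀ y n), law_killedVisit]

theorem killedStep_tsum {E : Type*} (p : E → PMF E) (x₀ : E) (f : ℕ → E → ℝ≥0∞) (x : E) :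
    killedStep p x₀ (fun z => ∑' n, f n z) x = ∑' n, killedStep p x₀ (f n) x := by
  simp only [killedStep]
  rw [ENNReal.tsum_comm]
  refine tsum_congr fun z => ?_
  by_cases hz : z = x₀
  · simp [hz]
  · simp [hz, ENNReal.tsum_mul_left]

theorem green_eq_add_killedStep (p : E → PMF E) (x₀ x y : E) :
    green p x₀ x y =
      Set.indicator {y} 1 x + killedStep p x₀ (fun z => green p x₀ z y) x := by
  simp_rw [green_eq_tsum]
  rw [killedStep_tsum, tsum_eq_zero_add' ENNReal.summable]
  simp [Function.iterate_succ_apply']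

/-- The Green function is the smallest solution of its recursion. -/
theorem green_le (p : E → PMF E) (x₀ y : E) {g : E → ℝ≥0∞}
    (hg : ∀ x, Set.indicator {y} 1 x + killedStep p x₀ g x ≤ g x) (x : E) :
    green p x₀ x y ≤ g x := by
  rw [green_eq_tsum]
  refine ENNReal.tsum_le_of_sum_range_le fun N => ?_
  -- Partial sums obey the recursion: the sum of `N + 1` terms is the indicator plus `killedStep` of
  -- the sum of `N` terms, so the bound by `g` propagates.
  induction N generalizing x with
  | zero => simp
  | succ N ih =>
    rw [Finset.sum_range_succ']
    refine le_trans ?_ (hg x)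
    rw [add_comm]
    refine add_le_add le_rfl (le_trans ?_ (killedStep_mono p x₀ ih x))
    simp only [Function.iterate_succ_apply', killedStep]
    rw [← Summable.tsum_finsetSum fun _ _ => ENNReal.summable]
    refine ENNReal.tsum_le_tsum fun z => ?_
    by_cases hz : z = x₀
    · simp [hz]
    · simp [hz, Finset.mul_sum]

variable {p : E → PMF E} {x₀ : E} {L : E → ℝ≥0∞}

/-- Doob's transform of the chain killed at `x₀` by a positive harmonic function. -/
noncomputable def doob {E : Type*} {p : E → PMF E} {x₀ : E} {L : E → ℝ≥0∞}
    (hL : IsKilledHarmonic p x₀ L) (hpos : ∀ x, L x ≠ 0) (x : E) : PMF E :=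
  ⟨fun y => ({x₀}ᶜ : Set E).indicator (fun y => p x y * L y) y / L x, by
    have h : ∑' y, ({x₀}ᶜ : Set E).indicator (fun y => p x y * L y) y / L x = 1 := by
      simp_rw [div_eq_mul_inv]
      rw [ENNReal.tsum_mul_right, ← hL.2 x]
      exact ENNReal.mul_inv_cancel (hpos x) (hL.1 x).ne
    exact h ▸ ENNReal.summable.hasSum⟩

theorem doob_apply {E : Type*} {p : E → PMF E} {x₀ : E} {L : E → ℝ≥0∞}
    (hL : IsKilledHarmonic p x₀ L) (hpos : ∀ x, L x ≠ 0) (x y : E) :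
    L x * doob hL hpos x y = ({x₀}ᶜ : Set E).indicator (fun y => p x y * L y) y :=
  ENNReal.mul_div_cancel (hpos x) (hL.1 x).ne

/-- The transform may start at `x₀`, but it never jumps there; this makes a visit to `x₀` in
`lastVisit` the last one. -/
theorem doob_self {E : Type*} {p : E → PMF E} {x₀ : E} {L : E → ℝ≥0∞}
    (hL : IsKilledHarmonic p x₀ L) (hpos : ∀ x, L x ≠ 0) (x : E) :
    doob hL hpos x x₀ = 0 := by
  have := doob_apply hL hpos x x₀
  simpa [hpos x] using this

variable (hL : IsKilledHarmonic p x₀ L) (hpos : ∀ x, L x ≠ 0)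

/-- The ratios of values of `L` along the path telescope. -/
theorem law_doob_cyl (x : E) (n : ℕ) (s : ℕ → E) (hs : ∀ i, 1 ≤ i → i ≤ n → s i ≠ x₀) :
    L x * law (doob hL hpos) x (cyl n s) = law p x (cyl n s) * L (s n) := by
  by_cases h0 : s 0 = x
  swap
  · simp [law_cyl_of_ne _ h0]
  subst h0
  induction n with
  | zero => simp [law_cyl_zero]
  | succ n ih =>
    rw [law_cyl_succ, law_cyl_succ, ← mul_assoc, ih fun i h h' => hs i h (by omega), mul_assoc,
      doob_apply, Set.indicator_of_mem (by exact hs _ (by omega) le_rfl), mul_assoc]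

theorem law_doob_cyl_eq_zero (x : E) (n : ℕ) (s : ℕ → E) (i : ℕ) (hi : 1 ≤ i) (hin : i ≤ n)
    (hs : s i = x₀) : law (doob hL hpos) x (cyl n s) = 0 := by
  obtain ⟨j, rfl⟩ : ∃ j, i = j + 1 := ⟨i - 1, by omega⟩
  refine measure_mono_null (t := cyl (j + 1) s) (fun ω hω k hk => hω k (by omega)) ?_
  rw [law_cyl_succ, hs, doob_self, mul_zero]

theorem law_doob_avoid (x : E) : ∀ᵐ ω ∂(law (doob hL hpos) x), ω ∈ avoid x₀ 1 := by
  have : ∀ k ≥ 1, ∀ᵐ ω ∂(law (doob hL hpos) x), ω k ≠ x₀ := by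
    intro k hk
    rw [ae_iff]
    refine null_of_cyl k fun ω hω => measure_mono_null Set.inter_subset_left ?_
    exact law_doob_cyl_eq_zero hL hpos x k ω k hk le_rfl (by simpa using hω)
  filter_upwards [ae_all_iff.2 fun k => ae_all_iff.2 (this k)] with ω hω
  exact hω

theorem law_doob_cyl_inter_avoid (x : E) {n : ℕ} {s : ℕ → E} (h : 1 ≤ n ∨ x ≠ x₀) :
    law (doob hL hpos) x (cyl n s ∩ avoid x₀ n) = law (doob hL hpos) x (cyl n s) := by
  refine measure_congr ?_
  have h0 : ∀ᵐ ω ∂(law (doob hL hpos) x), ω 0 = x := law_start _ x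
  filter_upwards [law_doob_avoid hL hpos x, h0] with ω hω h0
  refine propext (and_iff_left fun k hk => ?_)
  rcases Nat.eq_zero_or_pos k with rfl | hk'
  · rw [h0]
    exact h.resolve_left (by omega)
  · exact hω k hk'

/-- The expected number of visits to `y` under the transform is `green p x₀ x y * L y / L x`, which
is finite; Borel–Cantelli concludes. -/
theorem law_doob_transient (hG : ∀ x y, green p x₀ x y ≠ ∞) (x y : E) :
    law (doob hL hpos) x {ω | {n | ω n = y}.Infinite} = 0 := by
  have h : ∀ n x, L x * law (doob hL hpos) x {ω | ω n = y} =
      (killedStep p x₀)^[n] (Set.indicator {y} 1) x * L y := by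
    intro n
    induction n with
    | zero =>
      intro x
      by_cases hx : x = y
      · subst hx
        rw [law_congr _ x (A := {ω | ω 0 = x}) (B := Set.univ) fun ω hω => iff_of_true hω trivial]
        simp
      · rw [law_congr _ x (A := {ω | ω 0 = y}) (B := ∅) fun ω hω => iff_of_false (fun h => hx (hω.symm.trans h)) id]
        simp [hx]
    | succ n ih =>
      intro x
      rw [law_apply _ x (measurableSet_eval_eq _ _), Function.iterate_succ_apply', killedStep,
        ← ENNReal.tsum_mul_left, ← ENNReal.tsum_mul_right]
      refine tsum_congr fun z => ?_
      rw [← mul_assoc, doob_apply]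
      by_cases hz : z = x₀
      · simp [hz]
      · have e : cons x ⁻¹' {ω | ω (n + 1) = y} = {ω | ω n = y} := rfl
        rw [Set.indicator_of_mem (by exact hz), Set.indicator_of_mem (by exact hz), e, mul_assoc,
          ih, mul_assoc]
  have hs : ∑' n, law (doob hL hpos) x {ω | ω n = y} ≠ ∞ := by
    have : L x * ∑' n, law (doob hL hpos) x {ω | ω n = y} ≠ ∞ := by
      rw [← ENNReal.tsum_mul_left]
      simp_rw [h _ x]
      rw [ENNReal.tsum_mul_right, ← green_eq_tsum]
      exact ENNReal.mul_ne_top (hG x y) (hL.1 y).ne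
    intro h'
    rw [h'] at this
    exact this (ENNReal.mul_top (hpos x))
  have := measure_limsup_atTop_eq_zero hs
  refine measure_mono_null (fun ω hω => ?_) this
  rw [Filter.mem_limsup_iff_frequently_mem]
  exact Nat.frequently_atTop_iff_infinite.2 hω

end Killed

/-! ### Families attached to a function, and their relation to class `𝒬`. -/

section QFamily

variable {E : Type*} [MeasurableSpace E] [Countable E] [MeasurableSingletonClass E]
  {p : E → PMF E} {x₀ : E} {φ : E → ℝ≥0∞} {Q : E → Measure (ℕ → E)}

theorem lintegral_law_cyl (x : E) (n : ℕ) (s : ℕ → E) :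
    ∫⁻ ω, (cyl n s).indicator 1 ω * φ (ω n) ∂(law p x) = law p x (cyl n s) * φ (s n) := by
  have : ∀ ω, (cyl n s).indicator 1 ω * φ (ω n) =
      (cyl n s).indicator (fun _ => φ (s n)) ω := by
    intro ω
    by_cases h : ω ∈ cyl n s
    · simp [h, h n le_rfl]
    · simp [h]
  simp_rw [this]
  rw [lintegral_indicator_const (measurableSet_cyl n s), mul_comm]

theorem measurable_piLE_indicator_cyl {E : Type*} [MeasurableSpace E]
    [MeasurableSingletonClass E] (n : ℕ) (s : ℕ → E) :
    Measurable[(Filtration.piLE (X := fun _ : ℕ => E)) n]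
      ((cyl n s).indicator (1 : (ℕ → E) → ℝ≥0∞)) := by
  have hG : Measurable (({Preorder.frestrictLe (π := fun _ : ℕ => E) n s} : Set _).indicator
      (1 : ((i : Finset.Iic n) → E) → ℝ≥0∞)) := measurable_one.indicator (measurableSet_singleton _)
  rw [Filtration.piLE_eq_comap_frestrictLe]
  convert hG.comp (comap_measurable (Preorder.frestrictLe (π := fun _ : ℕ => E) n)) using 1
  funext ω
  have : ω ∈ cyl n s ↔ Preorder.frestrictLe (π := fun _ : ℕ => E) n ω ∈
      ({Preorder.frestrictLe (π := fun _ : ℕ => E) n s} : Set _) := by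
    simp only [Set.mem_singleton_iff, funext_iff]
    exact ⟨fun h i => h i (Finset.mem_Iic.1 i.2), fun h i hi => h ⟨i, Finset.mem_Iic.2 hi⟩⟩
  by_cases h : ω ∈ cyl n s
  · rw [Set.indicator_of_mem h, Function.comp, Set.indicator_of_mem (this.1 h)]
    rfl
  · rw [Set.indicator_of_notMem h, Function.comp, Set.indicator_of_notMem (mt this.2 h)]

theorem IsQFamily.apply_cyl (hQ : IsQFamily p x₀ φ Q) (x : E) (n : ℕ) (s : ℕ → E) :
    Q x (cyl n s ∩ avoid x₀ n) = law p x (cyl n s) * φ (s n) := by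
  have h := hQ.lintegral_avoid x n _ (measurable_piLE_indicator_cyl n s)
  rw [lintegral_law_cyl] at h
  rw [← h, Set.inter_comm,
    ← lintegral_indicator_one ((measurableSet_avoid x₀ n).inter (measurableSet_cyl n s)),
    ← Set.indicator_indicator]
  rfl

theorem IsQFamily.infinite_eq_zero (hQ : IsQFamily p x₀ φ Q) (x y : E) :
    Q x {ω | {n | ω n = y}.Infinite} = 0 := by
  simpa only [infinite_one_le_iff] using hQ.transient x y

/-- Cylinder identities are enough: they give a countable cover by sets of finite mass, hence
σ-finiteness. They also say that `Q x` restricted to `avoid x₀ n` and the measure with density `φ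
(X_n)` agree on histories up to time `n`, hence on every admissible `F`. -/
theorem IsQFamily.of_cyl (hφ : ∀ x, φ x ≠ ∞) (start : ∀ x, Q x {ω | ω 0 ≠ x} = 0)
    (transient : ∀ x y, Q x {ω | {n | ω n = y}.Infinite} = 0)
    (h : ∀ x n s, Q x (cyl n s ∩ avoid x₀ n) = law p x (cyl n s) * φ (s n)) :
    IsQFamily p x₀ φ Q := by
  refine ⟨fun x => ?_, start, fun x y => by simpa only [infinite_one_le_iff] using transient x y,
    fun x n F hF => ?_⟩
  · refine Measure.sigmaFinite_of_countable
      (S := {{ω | {n | ω n = x₀}.Infinite}} ∪ ⋃ n, (· ∩ avoid x₀ n) '' Set.range (cyl n)) ?_ ?_ ?_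
    · exact (Set.countable_singleton _).union (Set.countable_iUnion fun n =>
        (countable_range_cyl n).image _)
    · rintro A (rfl | hA)
      · simp [transient]
      · obtain ⟨n, _, ⟨s, rfl⟩, rfl⟩ := Set.mem_iUnion.1 hA
        rw [h]
        exact ENNReal.mul_lt_top (measure_lt_top _ _) (hφ _).lt_top
    · refine Set.eq_univ_of_forall fun ω => ?_
      by_cases hω : ω ∈ {ω : ℕ → E | {n | ω n = x₀}.Infinite}
      · exact ⟨_, Or.inl rfl, hω⟩
      · have : ω ∈ {ω : ℕ → E | {n | ω n = x₀}.Infinite}ᶜ := hω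
        rw [← avoid_eq_compl_infinite x₀ 0] at this
        simp only [Set.mem_iUnion] at this
        obtain ⟨n, -, hω⟩ := this
        exact ⟨cyl n ω ∩ avoid x₀ n, Or.inr (Set.mem_iUnion.2 ⟨n, _, ⟨ω, rfl⟩, rfl⟩),
          fun _ _ => rfl, hω⟩
  · have hF' := hF.mono ((Filtration.piLE (X := fun _ : ℕ => E)).le n) le_rfl
    have hm : Measurable fun ω : ℕ → E => φ (ω n) :=
      (measurable_of_countable φ).comp (measurable_pi_apply n)
    have e := lintegral_eq_of_cyl (μ := (Q x).restrict (avoid x₀ n))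
      (ν := (law p x).withDensity fun ω => φ (ω n)) (n := n) (fun s => ?_) hF
    · rw [lintegral_withDensity_eq_lintegral_mul _ hm hF',
        ← lintegral_indicator (measurableSet_avoid x₀ n)] at e
      refine e.trans (lintegral_congr fun ω => mul_comm _ _)
    · rw [Measure.restrict_apply (measurableSet_cyl n s), h,
        withDensity_apply _ (measurableSet_cyl n s),
        ← lintegral_indicator (measurableSet_cyl n s), ← lintegral_law_cyl]
      refine lintegral_congr fun ω => ?_
      by_cases hω : ω ∈ cyl n s <;> simp [hω]

theorem IsQFamily.unique (hφ : ∀ x, φ x ≠ ∞) {Q' : E → Measure (ℕ → E)}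
    (hQ : IsQFamily p x₀ φ Q) (hQ' : IsQFamily p x₀ φ Q') : Q = Q' := by
  funext x
  refine ext_of_cyl_inter_avoid x₀ 0 (hQ.infinite_eq_zero x x₀) (hQ'.infinite_eq_zero x x₀) ?_ ?_
  · intro n _ s
    rw [hQ.apply_cyl]
    exact ENNReal.mul_ne_top (measure_ne_top _ _) (hφ _)
  · intro n _ s
    rw [hQ.apply_cyl, hQ'.apply_cyl]

theorem IsQFamily.smul (hφ : ∀ x, φ x ≠ ∞) (hQ : IsQFamily p x₀ φ Q) (c : ℝ≥0) :
    IsQFamily p x₀ (fun x => c * φ x) fun x => c • Q x := by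
  refine .of_cyl (fun x => ENNReal.mul_ne_top ENNReal.coe_ne_top (hφ x)) (fun x => ?_)
    (fun x y => ?_) fun x n s => ?_
  · simp [hQ.start x]
  · simp [hQ.infinite_eq_zero x y]
  · rw [Measure.smul_apply, hQ.apply_cyl, ENNReal.smul_def, smul_eq_mul, mul_left_comm]

theorem measurable_concat {E : Type*} [MeasurableSpace E] (n : ℕ) :
    Measurable (concat (E := E) n) := by
  refine measurable_pi_lambda _ fun k => ?_
  by_cases hk : k ≤ n
  · simp only [concat, hk, if_true]
    exact (measurable_pi_apply k).comp measurable_fst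
  · simp only [concat, hk, if_false]
    exact (measurable_pi_apply (k - n)).comp measurable_snd

theorem concat_of_le {E : Type*} {n k : ℕ} (h : k ≤ n) (c : (ℕ → E) × (ℕ → E)) :
    concat n c k = c.1 k := if_pos h

theorem concat_add {E : Type*} {n k : ℕ} (h : 1 ≤ k) (c : (ℕ → E) × (ℕ → E)) :
    concat n c (n + k) = c.2 k := by
  rw [concat, if_neg (by omega), Nat.add_sub_cancel_left]

/-- Concatenation discards `η 0`, so the hypothesis on `ν` is what makes the second factor a full
cylinder. With `1 ≤ k` the avoidance condition concerns the second trajectory only. -/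
theorem map_concat_apply {E : Type*} [MeasurableSpace E] [MeasurableSingletonClass E] {x₀ : E}
    {μ ν : Measure (ℕ → E)} [SFinite μ] [SFinite ν] {n k : ℕ} (hk : 1 ≤ k)
    {s : ℕ → E} (hν : ∀ᵐ η ∂ν, η 0 = s n) :
    (μ.prod ν).map (concat n) (cyl (n + k) s ∩ avoid x₀ (n + k)) =
      μ (cyl n s) * ν (cyl k (fun i => s (n + i)) ∩ avoid x₀ k) := by
  rw [Measure.map_apply (measurable_concat n)
    ((measurableSet_cyl _ _).inter (measurableSet_avoid _ _)), ← Measure.prod_prod]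
  refine measure_congr ?_
  have : ∀ᵐ c ∂(μ.prod ν), c.2 0 = s n := Measure.quasiMeasurePreserving_snd.ae hν
  filter_upwards [this] with c hc
  refine propext ⟨fun h => ⟨fun i hi => ?_, fun i hi => ?_, fun i hi => ?_⟩,
    fun h => ⟨fun i hi => ?_, fun i hi => ?_⟩⟩
  · rw [← concat_of_le hi c]
    exact h.1 i (by omega)
  · rcases Nat.eq_zero_or_pos i with rfl | hi'
    · exact hc
    · rw [← concat_add hi' c]
      exact h.1 _ (by omega)
  · rw [← concat_add (by omega : 1 ≤ i) c]
    exact h.2 _ (by omega)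
  · rcases le_or_gt i n with h' | h'
    · rw [concat_of_le h']
      exact h.1 i h'
    · obtain ⟨j, rfl⟩ := Nat.exists_eq_add_of_le h'.le
      rw [concat_add (by omega)]
      exact h.2.1 j (by omega)
  · obtain ⟨j, rfl⟩ := Nat.exists_eq_add_of_le (show n ≤ i by omega)
    rw [concat_add (by omega)]
    exact h.2.2 j (by omega)

theorem map_concat_infinite {E : Type*} [MeasurableSpace E] [MeasurableSingletonClass E]
    {μ ν : Measure (ℕ → E)} [SFinite ν] (n : ℕ) {y : E}
    (hν : ν {ω | {k | ω k = y}.Infinite} = 0) :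
    (μ.prod ν).map (concat n) {ω | {k | ω k = y}.Infinite} = 0 := by
  rw [Measure.map_apply (measurable_concat n) (measurableSet_infinite y)]
  have : ∀ᵐ c ∂(μ.prod ν), c.2 ∉ {ω | {k | ω k = y}.Infinite} :=
    Measure.quasiMeasurePreserving_snd.ae (measure_eq_zero_iff_ae_notMem.1 hν)
  refine measure_eq_zero_iff_ae_notMem.2 ?_
  filter_upwards [this] with c hfin hc
  have hfin' : {k | c.2 k = y}.Finite := Set.not_infinite.1 hfin
  refine hc (((Set.finite_Iic n).union (hfin'.image (n + ·))).subset fun k hk => ?_)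
  rcases le_or_gt k n with h' | h'
  · exact Or.inl h'
  · obtain ⟨j, rfl⟩ := Nat.exists_eq_add_of_le h'.le
    refine Or.inr ⟨j, ?_, rfl⟩
    rwa [Set.mem_ofPred_eq, concat_add (by omega)] at hk

theorem IsQFamily.classQ (hφ : ∀ x, φ x ≠ ∞) (hQ : IsQFamily p x₀ φ Q)
    (havoid : ∀ y x, Q x (avoid y 0) < ∞) : ClassQ p Q := by
  have hσ := hQ.sigmaFinite
  refine ⟨hσ, fun n x y => ?_, fun y x => ?_, fun y x => hQ.infinite_eq_zero x y⟩
  · have hm := measurableSet_eval_eq (E := E) n y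
    have hc : ∀ m s, MeasurableSet (cyl m s ∩ avoid x₀ m) := fun m s =>
      (measurableSet_cyl m s).inter (measurableSet_avoid x₀ m)
    -- Testing from time `n + 1` on keeps all avoidance conditions strictly after the gluing time.
    refine ext_of_cyl_inter_avoid x₀ (n + 1) ?_ ?_ ?_ ?_
    · exact le_antisymm ((Measure.restrict_apply_le _ _).trans (hQ.infinite_eq_zero x x₀).le)
        zero_le
    · exact le_antisymm ((Measure.restrict_apply_le _ _).trans
        (map_concat_infinite n (hQ.infinite_eq_zero y x₀)).le) zero_le
    · intro m _ s
      refine ne_top_of_le_ne_top ?_ (Measure.restrict_apply_le _ _)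
      rw [hQ.apply_cyl]
      exact ENNReal.mul_ne_top (measure_ne_top _ _) (hφ _)
    · intro m hm' s
      obtain ⟨k, rfl⟩ := Nat.exists_eq_add_of_le (show n ≤ m by omega)
      rw [Measure.restrict_apply (hc _ _), Measure.restrict_apply (hc _ _)]
      by_cases hs : s n = y
      · subst hs
        have : cyl (n + k) s ∩ avoid x₀ (n + k) ∩ {ω | ω n = s n} =
            cyl (n + k) s ∩ avoid x₀ (n + k) :=
          Set.inter_eq_left.2 fun ω hω => hω.1 n (by omega)
        rw [this, map_concat_apply (by omega) (hQ.start (s n)), hQ.apply_cyl, hQ.apply_cyl,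
          law_cyl_add, mul_assoc]
      · have : cyl (n + k) s ∩ avoid x₀ (n + k) ∩ {ω | ω n = y} = ∅ := by
          ext ω
          simp only [Set.mem_inter_iff, Set.mem_empty_iff_false, iff_false, not_and]
          exact fun hω h => hs ((hω.1 n (by omega)).symm.trans h)
        simp [this]
  · have := havoid y x
    simpa [avoid] using this

/-- The Markov identity at `n = 0` transfers the starting point from `law p x` to `Q x`. -/
theorem ClassQ.start (hQ : ClassQ p Q) (x : E) : Q x {ω | ω 0 ≠ x} = 0 := by
  have hσ := hQ.sigmaFinite
  have h : ∀ y ≠ x, Q x {ω | ω 0 = y} = 0 := by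
    intro y hy
    have h := congrArg (fun μ => μ {ω | ω 0 = y}) (hQ.markov 0 x y)
    simp only [Measure.restrict_apply_self] at h
    rw [h, Measure.map_apply (measurable_concat 0) (measurableSet_eval_eq 0 y)]
    have : concat 0 ⁻¹' {ω : ℕ → E | ω 0 = y} = {ω | ω 0 = y} ×ˢ Set.univ := by
      ext c
      simp [concat]
    rw [this, Measure.prod_prod, law_congr p x (B := ∅) fun ω hω =>
      iff_of_false (fun h => hy (h.symm.trans hω)) id]
    simp
  have : {ω : ℕ → E | ω 0 ≠ x} = ⋃ y, ⋃ (_ : y ≠ x), {ω | ω 0 = y} := by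
    ext ω; simp
  rw [this]
  exact measure_iUnion_null fun y => measure_iUnion_null fun hy => h y hy

theorem ClassQ.avoid_self (hQ : ClassQ p Q) (x₀ : E) : Q x₀ (avoid x₀ 0) = 0 :=
  measure_mono_null (fun _ hω => hω 0 le_rfl) (hQ.start x₀)

/-- The Markov identity at time `n` splits a test event into a history and a future started at `s n`
that never meets `x₀`. When `s n = x₀` both sides vanish. -/
theorem ClassQ.isQFamily (hQ : ClassQ p Q) (x₀ : E) :
    IsQFamily p x₀ (fun x => Q x (avoid x₀ 0)) Q := by
  have hσ := hQ.sigmaFinite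
  refine .of_cyl (fun x => ?_) hQ.start (fun x y => hQ.transient y x) fun x n s => ?_
  · have := hQ.avoid_lt_top x₀ x
    simpa [avoid] using this.ne
  · have hc : MeasurableSet (cyl n s ∩ avoid x₀ n) :=
      (measurableSet_cyl n s).inter (measurableSet_avoid x₀ n)
    have h := congrArg (fun μ => μ (cyl n s ∩ avoid x₀ n)) (hQ.markov n x (s n))
    have hst : ∀ᵐ η ∂(Q (s n)), η 0 = s n := hQ.start (s n)
    have e : cyl n s ∩ avoid x₀ n ∩ {ω | ω n = s n} = cyl n s ∩ avoid x₀ n :=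
      Set.inter_eq_left.2 fun ω hω => hω.1 n le_rfl
    simp only [Measure.restrict_apply hc, e] at h
    rw [h, Measure.map_apply (measurable_concat n) hc]
    by_cases hs : s n = x₀
    · have h1 : cyl n s ∩ avoid x₀ n = ∅ := by
        ext ω
        simp only [Set.mem_inter_iff, Set.mem_empty_iff_false, iff_false, not_and]
        exact fun hω h => h n le_rfl ((hω n le_rfl).trans hs)
      have h2 : Q (s n) (avoid x₀ 0) = 0 := hs ▸ hQ.avoid_self x₀
      rw [h1, h2]
      simp
    · rw [← Measure.prod_prod]
      refine measure_congr ?_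
      have : ∀ᵐ c ∂((law p x).prod (Q (s n))), c.2 0 = s n :=
        Measure.quasiMeasurePreserving_snd.ae hst
      filter_upwards [this] with c hc
      refine propext ⟨fun h => ⟨fun i hi => ?_, fun i _ => ?_⟩, fun h => ⟨fun i hi => ?_, fun i hi => ?_⟩⟩
      · rw [← concat_of_le hi c]
        exact h.1 i hi
      · rcases Nat.eq_zero_or_pos i with rfl | hi'
        · rwa [hc]
        · rw [← concat_add hi' c]
          exact h.2 _ (by omega)
      · rw [concat_of_le hi]
        exact h.1 i hi
      · obtain ⟨j, rfl⟩ := Nat.exists_eq_add_of_le (show n ≤ i from hi)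
        rcases Nat.eq_zero_or_pos j with rfl | hj
        · rw [add_zero, concat_of_le le_rfl, h.1 n le_rfl]
          exact hs
        · rw [concat_add hj]
          exact h.2 j (zero_le)

/-- Off `x₀`, avoiding from time `0` and from time `1` are almost everywhere the same; the defining
identity of the family with `n = 1` and `F = 1` then gives harmonicity. -/
theorem ClassQ.avoid_eq_tsum (hQ : ClassQ p Q) {x₀ x : E} (hx : x ≠ x₀) :
    Q x (avoid x₀ 0) = ∑' z, p x z * Q z (avoid x₀ 0) := by
  have h := (hQ.isQFamily x₀).lintegral_avoid x 1 (fun _ => 1) measurable_const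
  have e : Q x (avoid x₀ 0) = Q x (avoid x₀ 1) := by
    refine measure_congr ?_
    have hst : ∀ᵐ η ∂(Q x), η 0 = x := hQ.start x
    filter_upwards [hst] with η hη
    refine propext ⟨fun h => avoid_mono x₀ zero_le_one h, fun h k _ => ?_⟩
    rcases Nat.eq_zero_or_pos k with rfl | hk
    · rwa [hη]
    · exact h k hk
  rw [e, ← lintegral_indicator_one (measurableSet_avoid x₀ 1)]
  refine h.trans ?_
  have hm : Measurable fun ω : ℕ → E => Q (ω 1) (avoid x₀ 0) :=
    (measurable_of_countable fun y => Q y (avoid x₀ 0)).comp (measurable_pi_apply 1)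
  simp only [one_mul]
  rw [lintegral_law p x hm]
  refine tsum_congr fun z => ?_
  congr 1
  have hst : ∀ᵐ η ∂(law p z), η 0 = z := law_start p z
  have : ∀ᵐ η ∂(law p z), Q (cons x η 1) (avoid x₀ 0) = Q z (avoid x₀ 0) := by
    filter_upwards [hst] with η hη
    rw [← hη]; rfl
  rw [lintegral_congr_ae this]
  simp

end QFamily

/-! ### Existence by last exit, and classification of class `𝒬`. -/

section Existence

variable {E : Type*} [MeasurableSpace E] [Countable E] [MeasurableSingletonClass E]
  {p : E → PMF E} {x₀ : E} {L : E → ℝ≥0∞}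
  (hL : IsKilledHarmonic p x₀ L) (hpos : ∀ x, L x ≠ 0)

/-- The part of the measure `ℚ_x` where the trajectory never visits `x₀`. -/
noncomputable def neverVisit (x : E) : Measure (ℕ → E) :=
  ({x₀}ᶜ : Set E).indicator (fun x => L x • law (doob hL hpos) x) x

/-- The part of the measure `ℚ_x` where the last visit to `x₀` takes place at time `m`. -/
noncomputable def lastVisit (x : E) (m : ℕ) : Measure (ℕ → E) :=
  (((law p x).restrict {ω | ω m = x₀}).prod (L x₀ • law (doob hL hpos) x₀)).map (concat m)

/-- The measure `ℚ_x`, obtained by gluing a trajectory of Doob's transform to the chain at its last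
visit to `x₀`. -/
noncomputable def lastExit (x : E) : Measure (ℕ → E) :=
  neverVisit hL hpos x + Measure.sum fun m => lastVisit hL hpos x m

theorem neverVisit_cyl (x : E) (n : ℕ) (s : ℕ → E) (hs : ∀ i ≤ n, s i ≠ x₀) :
    neverVisit hL hpos x (cyl n s ∩ avoid x₀ n) = law p x (cyl n s) * L (s n) := by
  rw [neverVisit]
  by_cases hx : x = x₀
  · rw [Set.indicator_of_notMem (by simpa using hx), law_cyl_of_ne p (fun h => hs 0 zero_le (h.trans hx))]
    simp
  · rw [Set.indicator_of_mem (by exact hx), Measure.smul_apply, smul_eq_mul,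
      law_doob_cyl_inter_avoid hL hpos x (Or.inr hx), law_doob_cyl hL hpos x n s fun i _ => hs i]

theorem neverVisit_cyl_eq_zero (x : E) (n : ℕ) (s : ℕ → E) (i : ℕ) (hi : i ≤ n) (hs : s i = x₀) :
    neverVisit hL hpos x (cyl n s) = 0 := by
  rw [neverVisit]
  by_cases hx : x = x₀
  · rw [Set.indicator_of_notMem (by simpa using hx)]
    simp
  · rw [Set.indicator_of_mem (by exact hx), Measure.smul_apply, smul_eq_mul]
    rcases Nat.eq_zero_or_pos i with rfl | hi'
    · rw [law_cyl_of_ne _ fun h => hx (h.symm.trans hs), mul_zero]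
    · rw [law_doob_cyl_eq_zero hL hpos x n s i hi' hi hs, mul_zero]

theorem ae_lastVisit (x : E) (m : ℕ) : ∀ᵐ ω ∂(lastVisit hL hpos x m), ω m = x₀ ∧ ω 0 = x := by
  have hm : MeasurableSet {ω : ℕ → E | ω m = x₀ ∧ ω 0 = x} :=
    (measurableSet_eval_eq m x₀).inter (measurableSet_eval_eq 0 x)
  rw [lastVisit, ae_map_iff (measurable_concat m).aemeasurable hm]
  have h1 : ∀ᵐ ω ∂((law p x).restrict {ω | ω m = x₀}), ω m = x₀ ∧ ω 0 = x := by
    rw [ae_restrict_iff' (measurableSet_eval_eq m x₀)]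
    have : ∀ᵐ ω ∂(law p x), ω 0 = x := law_start p x
    filter_upwards [this] with ω hω h using ⟨h, hω⟩
  have h2 := Measure.quasiMeasurePreserving_fst (μ := (law p x).restrict {ω | ω m = x₀})
    (ν := L x₀ • law (doob hL hpos) x₀) |>.ae h1
  filter_upwards [h2] with c hc
  rwa [concat_of_le le_rfl, concat_of_le zero_le]

theorem lastVisit_cyl_of_ne (x : E) {m n : ℕ} (hmn : m ≤ n) (s : ℕ → E) (hs : s m ≠ x₀) :
    lastVisit hL hpos x m (cyl n s) = 0 := by
  refine measure_eq_zero_iff_ae_notMem.2 ?_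
  filter_upwards [ae_lastVisit hL hpos x m] with ω hω h
  exact hs ((h m hmn).symm.trans hω.1)

theorem lastVisit_avoid (x : E) {m n : ℕ} (hmn : n ≤ m) :
    lastVisit hL hpos x m (avoid x₀ n) = 0 := by
  refine measure_eq_zero_iff_ae_notMem.2 ?_
  filter_upwards [ae_lastVisit hL hpos x m] with ω hω h
  exact h m hmn hω.1

theorem lastVisit_cyl_inter_avoid (x : E) {m k : ℕ} (hk : 1 ≤ k) (s : ℕ → E) (hs : s m = x₀) :
    lastVisit hL hpos x m (cyl (m + k) s ∩ avoid x₀ (m + k)) =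
      law p x (cyl m s) * (L x₀ * law (doob hL hpos) x₀ (cyl k fun i => s (m + i))) := by
  have hst : ∀ᵐ η ∂(L x₀ • law (doob hL hpos) x₀), η 0 = s m := by
    rw [hs]
    exact Measure.ae_smul_measure (law_start (doob hL hpos) x₀) _
  rw [lastVisit, map_concat_apply hk hst, Measure.smul_apply, smul_eq_mul,
    law_doob_cyl_inter_avoid hL hpos x₀ (Or.inl hk), Measure.restrict_apply (measurableSet_cyl m s),
    Set.inter_eq_left.2 fun ω hω => ?_]
  exact (hω m le_rfl).trans hs

/-- At most one piece of the decomposition charges a given test event: `neverVisit` if `s` misses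
`x₀` up to time `n`, otherwise `lastVisit` at the last visit of `s` to `x₀`. -/
theorem lastExit_cyl (x : E) (n : ℕ) (s : ℕ → E) :
    lastExit hL hpos x (cyl n s ∩ avoid x₀ n) =
      law p x (cyl n s) * ({x₀}ᶜ : Set E).indicator L (s n) := by
  have hlate : ∀ m ≥ n, lastVisit hL hpos x m (cyl n s ∩ avoid x₀ n) = 0 := fun m hm =>
    measure_mono_null Set.inter_subset_right (lastVisit_avoid hL hpos x hm)
  have hoff : ∀ m ≤ n, s m ≠ x₀ → lastVisit hL hpos x m (cyl n s ∩ avoid x₀ n) = 0 :=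
    fun m hm h => measure_mono_null Set.inter_subset_left (lastVisit_cyl_of_ne hL hpos x hm s h)
  by_cases hn : s n = x₀
  · have : cyl n s ∩ avoid x₀ n = ∅ := by
      ext ω
      simp only [Set.mem_inter_iff, Set.mem_empty_iff_false, iff_false, not_and]
      exact fun hω h => h n le_rfl ((hω n le_rfl).trans hn)
    rw [this, Set.indicator_of_notMem (by simpa using hn)]
    simp
  rw [Set.indicator_of_mem (by exact hn), lastExit, Measure.add_apply,
    Measure.sum_apply _ ((measurableSet_cyl n s).inter (measurableSet_avoid x₀ n))]
  by_cases hs : ∀ i ≤ n, s i ≠ x₀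
  · rw [neverVisit_cyl hL hpos x n s hs, ENNReal.tsum_eq_zero.2, add_zero]
    intro m
    rcases le_total n m with h | h
    · exact hlate m h
    · exact hoff m h (hs m h)
  push Not at hs
  obtain ⟨i, hi, hix⟩ := hs
  obtain ⟨m, hm, hmax⟩ : ∃ m, (m ≤ n ∧ s m = x₀) ∧ ∀ j, m < j → j ≤ n → s j ≠ x₀ := by
    classical
    refine ⟨Nat.findGreatest (fun j => s j = x₀) n,
      ⟨Nat.findGreatest_le n, Nat.findGreatest_spec (P := fun j => s j = x₀) hi hix⟩, fun j h h' =>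
      Nat.findGreatest_is_greatest h h'⟩
  have hmn : m < n := lt_of_le_of_ne hm.1 fun h => hn (h ▸ hm.2)
  obtain ⟨k, rfl⟩ := Nat.exists_eq_add_of_le hm.1
  rw [measure_mono_null Set.inter_subset_left (neverVisit_cyl_eq_zero hL hpos x _ s i hi hix),
    zero_add, tsum_eq_single m]
  · rw [lastVisit_cyl_inter_avoid hL hpos x (by omega) s hm.2,
      law_doob_cyl hL hpos x₀ k _ fun j hj hj' => hmax _ (by omega) (by omega), law_cyl_add, hm.2,
      mul_assoc]
  · intro j hj
    rcases le_or_gt (m + k) j with h | h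
    · exact hlate j h
    -- Gluing before `m` would require Doob's transform to return to `x₀` at time `m`; gluing after
    -- `m` contradicts the maximality of `m`.
    rcases lt_or_gt_of_ne hj with h' | h'
    · by_cases hsj : s j = x₀
      · obtain ⟨l, hl⟩ := Nat.exists_eq_add_of_le h.le
        rw [hl, lastVisit_cyl_inter_avoid hL hpos x (by omega) s hsj,
          law_doob_cyl_eq_zero hL hpos x₀ l _ (m - j) (by omega) (by omega)
            (by rw [Nat.add_sub_cancel' h'.le, hm.2])]
        simp
      · exact hoff j h.le hsj
    · exact hoff j h.le (hmax j h' h.le)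

theorem isQFamily_lastExit (hG : ∀ x y, green p x₀ x y ≠ ∞) :
    IsQFamily p x₀ (({x₀}ᶜ : Set E).indicator L) (lastExit hL hpos) := by
  refine .of_cyl (fun x => ?_) (fun x => ?_) (fun x y => ?_) (lastExit_cyl hL hpos)
  · exact ne_top_of_le_ne_top (hL.1 x).ne (Set.indicator_le_self _ _ _)
  · have hm : MeasurableSet {ω : ℕ → E | ω 0 ≠ x} := (measurableSet_eval_eq 0 x).compl
    rw [lastExit, Measure.add_apply, Measure.sum_apply _ hm, ENNReal.tsum_eq_zero.2, add_zero]
    · rw [neverVisit]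
      by_cases hx : x = x₀
      · rw [Set.indicator_of_notMem (by simpa using hx)]
        simp
      · rw [Set.indicator_of_mem (by exact hx), Measure.smul_apply, law_start, smul_zero]
    · intro m
      exact (ae_lastVisit hL hpos x m).mono fun ω hω => hω.2
  · rw [lastExit, Measure.add_apply, Measure.sum_apply _ (measurableSet_infinite y),
      ENNReal.tsum_eq_zero.2, add_zero]
    · rw [neverVisit]
      by_cases hx : x = x₀
      · rw [Set.indicator_of_notMem (by simpa using hx)]
        simp
      · rw [Set.indicator_of_mem (by exact hx), Measure.smul_apply, law_doob_transient hL hpos hG,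
          smul_zero]
    · intro m
      refine map_concat_infinite m ?_
      rw [Measure.smul_apply, law_doob_transient hL hpos hG, smul_zero]

/-- If the functions that are harmonic off `x₀` and vanish at `x₀` are the multiples of `φ`, then the
class `𝒬` consists of the multiples of the family attached to `φ`. -/
theorem classQ_iff {φ : E → ℝ≥0∞} {Q₀ : E → Measure (ℕ → E)} (hφ : ∀ x, φ x ≠ ∞)
    (hQ₀ : IsQFamily p x₀ φ Q₀) (havoid : ∀ y x, Q₀ x (avoid y 0) < ∞)
    (hharm : ∀ ψ : E → ℝ≥0∞, (∀ x, ψ x ≠ ∞) → ψ x₀ = 0 →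
      (∀ x ≠ x₀, ψ x = ∑' z, p x z * ψ z) → ∃ c : ℝ≥0, ∀ x, ψ x = c * φ x)
    (Q : E → Measure (ℕ → E)) : ClassQ p Q ↔ ∃ c : ℝ≥0, ∀ x, Q x = c • Q₀ x := by
  constructor
  · intro hQ
    have hfin : ∀ x, Q x (avoid x₀ 0) ≠ ∞ := fun x => by
      have := hQ.avoid_lt_top x₀ x
      simpa [avoid] using this.ne
    obtain ⟨c, hc⟩ := hharm (fun x => Q x (avoid x₀ 0)) hfin (hQ.avoid_self x₀)
      fun x hx => hQ.avoid_eq_tsum hx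
    have h := hQ.isQFamily x₀
    rw [show (fun x => Q x (avoid x₀ 0)) = fun x => c * φ x from funext hc] at h
    exact ⟨c, fun x => congrFun (h.unique (fun x => hc x ▸ hfin x) (hQ₀.smul hφ c)) x⟩
  · rintro ⟨c, hc⟩
    obtain rfl : Q = fun x => c • Q₀ x := funext hc
    refine (hQ₀.smul hφ c).classQ (fun x => ENNReal.mul_ne_top ENNReal.coe_ne_top (hφ x)) ?_
    intro y x
    rw [Measure.smul_apply, ENNReal.smul_def, smul_eq_mul]
    exact ENNReal.mul_lt_top ENNReal.coe_lt_top (havoid y x)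

end Existence

/-! ### Finiteness of the mass avoiding a state, for unit steps. -/

section NearestNeighbour

/-- For a chain on `ℕ` with steps of size at most one that is transient under `Q`, a trajectory that
avoids some state avoids all smaller states or visits finitely many states. -/
theorem IsQFamily.avoid_lt_top {p : ℕ → PMF ℕ} {φ : ℕ → ℝ≥0∞} {Q : ℕ → Measure (ℕ → ℕ)}
    (hφ : ∀ x, φ x ≠ ∞) (hQ : IsQFamily p 0 φ Q)
    (hp : ∀ x y, p x y ≠ 0 → y ≤ x + 1 ∧ x ≤ y + 1) (y x : ℕ) : Q x (avoid y 0) < ∞ := by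
  -- The step bound passes from `law p x` to `Q x` on each `avoid 0 n` with `n ≥ k + 1`, and these
  -- events cover almost every trajectory.
  have hstep : ∀ᵐ ω ∂(Q x), ∀ k, ω (k + 1) ≤ ω k + 1 ∧ ω k ≤ ω (k + 1) + 1 := by
    refine ae_all_iff.2 fun k => measure_eq_zero_iff_ae_notMem.1 ?_ |>.mono fun ω h => not_not.1 h
    change Q x {ω | ¬(ω (k + 1) ≤ ω k + 1 ∧ ω k ≤ ω (k + 1) + 1)} = 0
    have hinf : ∀ᵐ ω ∂(Q x), ω ∉ {ω | {n | ω n = 0}.Infinite} :=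
      measure_eq_zero_iff_ae_notMem.1 (hQ.infinite_eq_zero x 0)
    have hav : ∀ n ≥ k + 1, ∀ᵐ ω ∂(Q x),
        ω ∈ avoid 0 n → (ω (k + 1) ≤ ω k + 1 ∧ ω k ≤ ω (k + 1) + 1) := by
      intro n hn
      rw [ae_iff]
      refine null_of_cyl n fun ω hω => ?_
      refine measure_mono_null (t := cyl n ω ∩ avoid 0 n) ?_ ?_
      · rintro η ⟨h1, h2⟩
        refine ⟨h1, ?_⟩
        by_contra hc
        exact h2 fun h => absurd h hc
      · rw [hQ.apply_cyl]
        have h0 : p (ω k) (ω (k + 1)) = 0 := by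
          by_contra hc
          exact hω fun _ => hp _ _ hc
        have : law p x (cyl n ω) = 0 := by
          refine measure_mono_null (t := cyl (k + 1) ω) (fun η hη i hi => hη i (by omega)) ?_
          rw [law_cyl_succ, h0, mul_zero]
        rw [this, zero_mul]
    have hav' := ae_all_iff.2 fun n => ae_all_iff.2 (hav n)
    refine ae_iff.1 ?_
    filter_upwards [hinf, hav'] with ω h1 h2
    have h3 : ω ∈ {ω : ℕ → ℕ | {n | ω n = 0}.Infinite}ᶜ := h1
    rw [← avoid_eq_compl_infinite 0 (k + 1)] at h3
    simp only [Set.mem_iUnion] at h3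
    obtain ⟨n, hn, h⟩ := h3
    exact h2 n hn h
  have htrans : ∀ᵐ ω ∂(Q x), ∀ z, ω ∉ {ω | {n | ω n = z}.Infinite} :=
    ae_all_iff.2 fun z => measure_eq_zero_iff_ae_notMem.1 (hQ.infinite_eq_zero x z)
  have hst : ∀ᵐ ω ∂(Q x), ω 0 = x := hQ.start x
  have hle : Q x (avoid y 0) ≤ Q x (cyl 0 (fun _ => x) ∩ avoid 0 0) := by
    refine measure_mono_ae ?_
    filter_upwards [hstep, htrans, hst] with ω h1 h2 h3 hω
    refine ⟨fun i hi => ?_, ?_⟩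
    · obtain rfl : i = 0 := by omega
      exact h3
    have hω' : ∀ k, ω k ≠ y := fun k => hω k zero_le
    -- A path below `y` that cannot cross it stays in a finite set, against transience; a path above
    -- `y` also avoids `0`.
    rcases lt_or_ge (ω 0) y with h | h
    · exfalso
      have hlt : ∀ k, ω k < y := by
        intro k
        induction k with
        | zero => exact h
        | succ k ih =>
          have := (h1 k).1
          have := hω' (k + 1)
          omega
      have hfin : ∀ z, {n | ω n = z}.Finite := fun z => Set.not_infinite.1 (h2 z)
      have : (Set.univ : Set ℕ) ⊆ ⋃ z ∈ Set.Iio y, {n | ω n = z} := by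
        intro n _
        simpa using hlt n
      exact Set.infinite_univ (((Set.finite_Iio y).biUnion fun z _ => hfin z).subset this)
    · have hgt : ∀ k, y < ω k := by
        intro k
        induction k with
        | zero => exact lt_of_le_of_ne h (hω' 0).symm
        | succ k ih =>
          have := (h1 k).2
          have := hω' (k + 1)
          omega
      exact fun k _ => (zero_le.trans_lt (hgt k)).ne'
  refine hle.trans_lt ?_
  rw [hQ.apply_cyl]
  exact ENNReal.mul_lt_top (measure_lt_top _ _) (hφ _).lt_top

end NearestNeighbour

/-! ### Recurrence from almost sure hitting. -/

section Recurrence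

variable {E : Type*} [MeasurableSpace E] [Countable E] [MeasurableSingletonClass E] (p : E → PMF E)

theorem law_avoid_succ (x y : E) (n : ℕ) :
    law p x (avoid y (n + 1)) = ∑' z, p x z * law p z (avoid y n) := by
  rw [law_apply p x (measurableSet_avoid y (n + 1))]
  refine tsum_congr fun z => ?_
  congr 2
  ext ω
  refine ⟨fun h k hk => h (k + 1) (by omega), fun h k hk => ?_⟩
  obtain ⟨k, rfl⟩ : ∃ j, k = j + 1 := ⟨k - 1, by omega⟩
  exact h k (by omega)

theorem law_avoid_self (y : E) : law p y (avoid y 0) = 0 :=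
  measure_mono_null (fun _ hω => hω 0 le_rfl) (law_start p y)

theorem law_avoid_eq_tsum {x y : E} (hx : x ≠ y) :
    law p x (avoid y 0) = ∑' z, p x z * law p z (avoid y 0) := by
  rw [← law_avoid_succ]
  refine law_congr p x fun ω hω => ⟨fun h => avoid_mono y zero_le_one h, fun h k _ => ?_⟩
  rcases Nat.eq_zero_or_pos k with rfl | hk
  · rwa [hω]
  · exact h k hk

theorem isRecurrentChain_of_avoid (h : ∀ x y, law p x (avoid y 0) = 0) : IsRecurrentChain p := by
  have h' : ∀ n x y, law p x (avoid y n) = 0 := by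
    intro n
    induction n with
    | zero => exact h
    | succ n ih =>
      intro x y
      rw [law_avoid_succ]
      simp [ih]
  intro x
  rw [← prob_compl_eq_zero_iff (measurableSet_infinite x), ← avoid_eq_compl_infinite x 0]
  exact measure_iUnion_null fun n => measure_iUnion_null fun _ => h' n x x

end Recurrence

/-! ### The second-order recurrence and its solutions. -/

section Harmonic

/-- The harmonic function `q (α ^ x - 1) / (1 - 2 q)` with `α = (1 - q) / q`. -/
noncomputable def harm (q : ℝ) (x : ℕ) : ℝ := q * (((1 - q) / q) ^ x - 1) / (1 - 2 * q)

variable {q : ℝ} (hq0 : 0 < q) (hq : q < 1 / 2)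

theorem harm_zero (q : ℝ) : harm q 0 = 0 := by simp [harm]

include hq0 hq

theorem one_lt_alpha : 1 < (1 - q) / q := by
  rw [one_lt_div hq0]
  linarith

theorem harm_one : harm q 1 = 1 := by
  have : 1 - 2 * q ≠ 0 := by linarith
  rw [harm, div_eq_one_iff_eq this]
  field_simp
  ring

theorem harm_succ_sub (x : ℕ) : harm q (x + 1) - harm q x = ((1 - q) / q) ^ x := by
  have : 1 - 2 * q ≠ 0 := by linarith
  rw [harm, harm, pow_succ, ← sub_div, div_eq_iff this]
  field_simp
  ring

theorem harm_succ (x : ℕ) : harm q (x + 1) = q * harm q (x + 2) + (1 - q) * harm q x := by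
  have h1 := harm_succ_sub hq0 hq x
  have h2 := harm_succ_sub hq0 hq (x + 1)
  have h3 : q * ((1 - q) / q) ^ (x + 1) = (1 - q) * ((1 - q) / q) ^ x := by
    rw [pow_succ]
    field_simp
  rw [← h1, ← h2] at h3
  linarith

/-- Bernoulli's inequality for the power of `(1 - q) / q`, together with `q * ((1 - q) / q - 1) = 1
- 2 * q`. -/
theorem le_harm (x : ℕ) : (x : ℝ) ≤ harm q x := by
  have h := one_add_mul_le_pow (a := (1 - q) / q - 1) (by linarith [one_lt_alpha hq0 hq]) x
  have h1 : 0 < 1 - 2 * q := by linarith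
  rw [harm, le_div_iff₀ h1]
  have h2 : q * ((1 - q) / q - 1) = 1 - 2 * q := by
    field_simp
    ring
  rw [add_sub_cancel] at h
  calc (x : ℝ) * (1 - 2 * q) = q * (x * ((1 - q) / q - 1)) := by rw [← h2]; ring
    _ ≤ _ := by gcongr; linarith

theorem harm_nonneg (x : ℕ) : 0 ≤ harm q x := x.cast_nonneg.trans (le_harm hq0 hq x)

theorem harm_pos {x : ℕ} (hx : 0 < x) : 0 < harm q x :=
  (Nat.cast_pos.2 hx).trans_le (le_harm hq0 hq x)

theorem harm_monotone : Monotone (harm q) := by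
  refine monotone_nat_of_le_succ fun n => ?_
  have h := harm_succ_sub hq0 hq n
  have : 0 < ((1 - q) / q) ^ n := pow_pos (by linarith [one_lt_alpha hq0 hq]) n
  linarith

theorem eq_mul_harm {h : ℕ → ℝ} (h0 : h 0 = 0) (hh : ∀ x, h (x + 1) = q * h (x + 2) + (1 - q) * h x)
    (x : ℕ) : h x = h 1 * harm q x := by
  induction x using Nat.twoStepInduction with
  | zero => rw [h0, harm_zero, mul_zero]
  | one => rw [harm_one hq0 hq, mul_one]
  | more x h1 h2 =>
    have h3 := hh x
    have h4 := harm_succ hq0 hq x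
    rw [h1, h2, h4] at h3
    have : q * (h (x + 2) - h 1 * harm q (x + 2)) = 0 := by linarith
    rcases mul_eq_zero.1 this with h | h
    · exact absurd h hq0.ne'
    · linarith

theorem eq_zero_of_bounded {h : ℕ → ℝ} (h0 : h 0 = 0)
    (hh : ∀ x, h (x + 1) = q * h (x + 2) + (1 - q) * h x) (hnn : ∀ x, 0 ≤ h x) {M : ℝ}
    (hM : ∀ x, h x ≤ M) (x : ℕ) : h x = 0 := by
  have e := eq_mul_harm hq0 hq h0 hh
  suffices h 1 = 0 by rw [e, this, zero_mul]
  by_contra hne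
  have hpos : 0 < h 1 := lt_of_le_of_ne (hnn 1) (Ne.symm hne)
  obtain ⟨n, hn⟩ := exists_nat_gt (M / h 1)
  rw [div_lt_iff₀ hpos] at hn
  have h1 := hM n
  rw [e n] at h1
  have h2 := mul_le_mul_of_nonneg_left (le_harm hq0 hq n) hpos.le
  linarith

end Harmonic

/-! ### Transition sums of the bang-bang walk. -/

section BangBang

variable {q : ℝ} (h0 : 0 ≤ q) (h1 : q ≤ 1)

theorem bangBang_apply (x y : ℕ) : bangBang q h0 h1 x y = ENNReal.ofReal (bangBangProb q x y) := rfl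

theorem bangBang_zero (y : ℕ) : bangBang q h0 h1 0 y = if y = 1 then 1 else 0 := by
  rw [bangBang_apply]
  by_cases hy : y = 1 <;> simp [bangBangProb, hy]

theorem bangBang_succ (x y : ℕ) : bangBang q h0 h1 (x + 1) y =
    (if y = x + 2 then ENNReal.ofReal q else 0) + (if y = x then ENNReal.ofReal (1 - q) else 0) := by
  rw [bangBang_apply]
  by_cases hy : y = x + 2
  · simp [bangBangProb, hy]
  · by_cases hy' : y = x
    · subst hy'
      have : y ≠ y + 1 + 1 := by omega
      simp [bangBangProb, this]
    · simp [bangBangProb, hy, hy']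

theorem tsum_bangBang_zero (f : ℕ → ℝ≥0∞) : ∑' z, bangBang q h0 h1 0 z * f z = f 1 := by
  rw [tsum_eq_single 1]
  · simp [bangBang_zero]
  · intro z hz
    simp [bangBang_zero, hz]

theorem tsum_bangBang_succ (f : ℕ → ℝ≥0∞) (x : ℕ) : ∑' z, bangBang q h0 h1 (x + 1) z * f z =
    ENNReal.ofReal q * f (x + 2) + ENNReal.ofReal (1 - q) * f x := by
  simp_rw [bangBang_succ, add_mul]
  rw [ENNReal.tsum_add, tsum_eq_single (x + 2), tsum_eq_single x]
  · simp
  · intro z hz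
    simp [hz]
  · intro z hz
    simp [hz]

theorem killedStep_eq {E : Type*} (p : E → PMF E) (x₀ : E) (f : E → ℝ≥0∞) (x : E) :
    killedStep p x₀ f x = ∑' z, p x z * ({x₀}ᶜ : Set E).indicator f z := by
  refine tsum_congr fun z => ?_
  by_cases hz : z = x₀ <;> simp [hz]

theorem killedStep_bangBang_zero (f : ℕ → ℝ≥0∞) : killedStep (bangBang q h0 h1) 0 f 0 = f 1 := by
  rw [killedStep_eq, tsum_bangBang_zero]
  simp

theorem killedStep_bangBang_succ (f : ℕ → ℝ≥0∞) (x : ℕ) :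
    killedStep (bangBang q h0 h1) 0 f (x + 1) =
      ENNReal.ofReal q * f (x + 2) + ENNReal.ofReal (1 - q) * ({0}ᶜ : Set ℕ).indicator f x := by
  rw [killedStep_eq, tsum_bangBang_succ]
  simp

theorem bangBang_step (x y : ℕ) (h : bangBang q h0 h1 x y ≠ 0) : y ≤ x + 1 ∧ x ≤ y + 1 := by
  contrapose! h
  cases x with
  | zero =>
    rw [bangBang_zero, if_neg (by omega)]
  | succ x =>
    rw [bangBang_succ, if_neg (by omega), if_neg (by omega), add_zero]

end BangBang

/-! ### Recurrence, harmonic functions, Green function and Martin kernel of the walk. -/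

section BangBangChain

variable {q : ℝ} {h0 : 0 ≤ q} {h1 : q ≤ 1} (hq0 : 0 < q) (hq : q < 1 / 2)

include hq0 hq

theorem toReal_step {a b c : ℝ≥0∞} (hb : b ≠ ∞) (hc : c ≠ ∞)
    (h : a = ENNReal.ofReal q * b + ENNReal.ofReal (1 - q) * c) :
    a.toReal = q * b.toReal + (1 - q) * c.toReal := by
  rw [h, ENNReal.toReal_add (ENNReal.mul_ne_top ENNReal.ofReal_ne_top hb)
    (ENNReal.mul_ne_top ENNReal.ofReal_ne_top hc), ENNReal.toReal_mul, ENNReal.toReal_mul,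
    ENNReal.toReal_ofReal hq0.le, ENNReal.toReal_ofReal (by linarith)]

theorem ofReal_step {a b c : ℝ} (hb : 0 ≤ b) (hc : 0 ≤ c) (h : a = q * b + (1 - q) * c) :
    ENNReal.ofReal a =
      ENNReal.ofReal q * ENNReal.ofReal b + ENNReal.ofReal (1 - q) * ENNReal.ofReal c := by
  have : 0 ≤ 1 - q := by linarith
  rw [h, ENNReal.ofReal_add (by positivity) (by positivity), ENNReal.ofReal_mul hq0.le,
    ENNReal.ofReal_mul this]

/-- Functions that vanish at `0` and are harmonic elsewhere are multiples of `harm`. -/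
theorem eq_mul_ofReal_harm {ψ : ℕ → ℝ≥0∞} (hfin : ∀ x, ψ x ≠ ∞) (hz : ψ 0 = 0)
    (hψ : ∀ x, ψ (x + 1) = ENNReal.ofReal q * ψ (x + 2) + ENNReal.ofReal (1 - q) * ψ x) (x : ℕ) :
    ψ x = ψ 1 * ENNReal.ofReal (harm q x) := by
  have h := eq_mul_harm hq0 hq (h := fun x => (ψ x).toReal) (by simp [hz])
    (fun x => toReal_step hq0 hq (hfin _) (hfin _) (hψ x)) x
  rw [← ENNReal.ofReal_toReal (hfin x), h, ENNReal.ofReal_mul ENNReal.toReal_nonneg,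
    ENNReal.ofReal_toReal (hfin 1)]

/-- Above `y`, the avoidance probability is a bounded solution of the recurrence vanishing at `y`,
hence zero. Below `y`, reflection at `0` makes it constant, equal to its value at `y`. -/
theorem law_bangBang_avoid (x y : ℕ) : law (bangBang q h0 h1) x (avoid y 0) = 0 := by
  set p := bangBang q h0 h1
  have hfin : ∀ x, law p x (avoid y 0) ≠ ∞ := fun x => measure_ne_top _ _
  have hself : law p y (avoid y 0) = 0 := law_avoid_self p y
  have hstep : ∀ x, x + 1 ≠ y → law p (x + 1) (avoid y 0) =
      ENNReal.ofReal q * law p (x + 2) (avoid y 0) +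
        ENNReal.ofReal (1 - q) * law p x (avoid y 0) := fun x hx => by
    rw [law_avoid_eq_tsum p hx, tsum_bangBang_succ]
  have hup : ∀ x, (law p (y + x) (avoid y 0)).toReal = 0 := by
    refine eq_zero_of_bounded hq0 hq (M := 1) (by simp [hself]) (fun x => ?_)
      (fun x => ENNReal.toReal_nonneg) fun x => ?_
    · exact toReal_step hq0 hq (hfin _) (hfin _) (hstep (y + x) (by omega))
    · exact ENNReal.toReal_le_of_le_ofReal zero_le_one (by simpa using prob_le_one)
  have hdown : ∀ x, x + 1 ≤ y →
      (law p (x + 1) (avoid y 0)).toReal = (law p x (avoid y 0)).toReal := by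
    intro x hx
    induction x with
    | zero =>
      congr 1
      conv_rhs => rw [law_avoid_eq_tsum p (show 0 ≠ y by omega), tsum_bangBang_zero]
    | succ x ih =>
      have h := toReal_step hq0 hq (hfin _) (hfin _) (hstep x (by omega))
      rw [← ih (by omega)] at h
      have : q * ((law p (x + 1 + 1) (avoid y 0)).toReal - (law p (x + 1) (avoid y 0)).toReal) = 0 := by
        linarith
      rcases mul_eq_zero.1 this with h | h
      · exact absurd h hq0.ne'
      · linarith
  have key : (law p x (avoid y 0)).toReal = 0 := by
    rcases le_total y x with h | h
    · obtain ⟨k, rfl⟩ := Nat.exists_eq_add_of_le h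
      exact hup k
    · induction h using Nat.decreasingInduction with
      | self => exact hup 0
      | of_succ k hk ih => rw [← hdown k hk, ih]
  exact ((ENNReal.toReal_eq_zero_iff _).1 key).resolve_right (hfin x)

theorem isRecurrentChain_bangBang : IsRecurrentChain (bangBang q h0 h1) :=
  isRecurrentChain_of_avoid _ (law_bangBang_avoid hq0 hq)

theorem isIrreducibleChain_bangBang : IsIrreducibleChain (bangBang q h0 h1) := by
  have hq' : 0 < ENNReal.ofReal q := ENNReal.ofReal_pos.2 hq0
  have hq'' : 0 < ENNReal.ofReal (1 - q) := ENNReal.ofReal_pos.2 (by linarith)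
  have hpath : ∀ (x y n : ℕ) (s : ℕ → ℕ), s 0 = x → s n = y →
      (∀ i < n, bangBang q h0 h1 (s i) (s (i + 1)) ≠ 0) →
        ∃ n, 0 < law (bangBang q h0 h1) x {ω | ω n = y} := by
    intro x y n s hx hy hs
    refine ⟨n, lt_of_lt_of_le ?_ (measure_mono (s := cyl n s) fun ω hω => (hω n le_rfl).trans hy)⟩
    rw [← hx, law_cyl, pos_iff_ne_zero]
    exact Finset.prod_ne_zero_iff.2 fun i hi => hs i (Finset.mem_range.1 hi)
  intro x y
  rcases le_total x y with h | h
  · refine hpath x y (y - x) (fun i => x + i) rfl (Nat.add_sub_cancel' h) fun i _ => ?_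
    simp only [← add_assoc]
    rcases Nat.eq_zero_or_pos (x + i) with hi | hi
    · rw [hi, bangBang_zero]
      simp
    · obtain ⟨j, hj⟩ := Nat.exists_eq_add_of_le' hi
      rw [hj, bangBang_succ, if_pos rfl]
      exact (hq'.trans_le le_self_add).ne'
  · refine hpath x y (x - y) (fun i => x - i) rfl (Nat.sub_sub_self h) fun i hi => ?_
    obtain ⟨j, hj⟩ := Nat.exists_eq_add_of_le' (show 1 ≤ x - i by omega)
    simp only [show x - (i + 1) = j by omega, hj]
    rw [bangBang_succ, if_pos rfl]
    exact (hq''.trans_le le_add_self).ne'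

/-- A bounded solution of the recursion of the Green function is the Green function. -/
theorem green_eq_of_bounded (y : ℕ) {G : ℕ → ℝ≥0∞} {M : ℝ≥0∞} (hM : M ≠ ∞) (hGM : ∀ x, G x ≤ M)
    (hG : ∀ x, G x = Set.indicator {y} 1 x + killedStep (bangBang q h0 h1) 0 G x) (x : ℕ) :
    green (bangBang q h0 h1) 0 x y = G x := by
  set p := bangBang q h0 h1
  set g : ℕ → ℝ≥0∞ := fun z => green p 0 z y with hg
  have hle : ∀ x, g x ≤ G x := green_le p 0 y fun x => (hG x).ge
  have hrec : ∀ x, g x = Set.indicator {y} 1 x + killedStep p 0 g x :=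
    fun x => green_eq_add_killedStep p 0 x y
  have hGfin : ∀ x, G x ≠ ∞ := fun x => ne_top_of_le_ne_top hM (hGM x)
  have hgfin : ∀ x, g x ≠ ∞ := fun x => ne_top_of_le_ne_top (hGfin x) (hle x)
  have hsub : ∀ {f : ℕ → ℝ≥0∞}, (∀ x, f x ≠ ∞) → (∀ x, f x = Set.indicator {y} 1 x + killedStep p 0 f x) →
      ∀ x, (f (x + 1)).toReal = (Set.indicator {y} (1 : ℕ → ℝ≥0∞) (x + 1)).toReal +
        (q * (f (x + 2)).toReal + (1 - q) * (({0}ᶜ : Set ℕ).indicator f x).toReal) := by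
    intro f hf h x
    have hi : ({0}ᶜ : Set ℕ).indicator f x ≠ ∞ :=
      ne_top_of_le_ne_top (hf x) (Set.indicator_le_self _ _ _)
    have h2 : ENNReal.ofReal q * f (x + 2) + ENNReal.ofReal (1 - q) * ({0}ᶜ : Set ℕ).indicator f x ≠ ∞ :=
      ENNReal.add_ne_top.2 ⟨ENNReal.mul_ne_top ENNReal.ofReal_ne_top (hf _),
        ENNReal.mul_ne_top ENNReal.ofReal_ne_top hi⟩
    conv_lhs => rw [h, killedStep_bangBang_succ]
    rw [ENNReal.toReal_add ?_ h2, toReal_step hq0 hq (hf _) hi rfl]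
    exact ne_top_of_le_ne_top ENNReal.one_ne_top (Set.indicator_le_self _ _ _)
  -- The difference of two solutions loses the source term. Its value at `0` is reset to zero, as
  -- killing requires; the true value at `0` is recovered from the value at `1`.
  have hd := eq_zero_of_bounded hq0 hq (M := M.toReal)
    (h := fun x => (({0}ᶜ : Set ℕ).indicator G x).toReal - (({0}ᶜ : Set ℕ).indicator g x).toReal)
    (by simp) (fun x => ?_) (fun x => ?_) fun x => ?_
  · have hpos : ∀ x, g (x + 1) = G (x + 1) := by
      intro x
      have h := hd (x + 1)
      rw [Set.indicator_of_mem (by simp), Set.indicator_of_mem (by simp)] at h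
      exact (ENNReal.toReal_eq_toReal_iff' (hgfin _) (hGfin _)).1 (by linarith)
    cases x with
    | zero =>
      change g 0 = G 0
      rw [hrec, hG, killedStep_bangBang_zero, killedStep_bangBang_zero, hpos 0]
    | succ x => exact hpos x
  · have e : ∀ (f : ℕ → ℝ≥0∞) k, ({0}ᶜ : Set ℕ).indicator f (k + 1) = f (k + 1) := fun f k =>
      Set.indicator_of_mem (by simp) _
    have h1 := hsub hGfin hG x
    have h2 := hsub hgfin hrec x
    simp only [e]
    linarith
  · by_cases hx : x = 0
    · simp [hx]
    · simp only [Set.indicator_of_mem (show x ∈ ({0}ᶜ : Set ℕ) from hx)]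
      exact sub_nonneg.2 (ENNReal.toReal_mono (hGfin x) (hle x))
  · refine (sub_le_self _ ENNReal.toReal_nonneg).trans (ENNReal.toReal_mono hM ?_)
    exact (Set.indicator_le_self _ _ _).trans (hGM x)

/-- The value at the boundary point of the Martin kernel. -/
noncomputable def limitL (q : ℝ) (x : ℕ) : ℝ≥0∞ := if x = 0 then 1 else ENNReal.ofReal (harm q x)

omit hq0 hq in
theorem indicator_limitL (x : ℕ) :
    ({0}ᶜ : Set ℕ).indicator (limitL q) x = ENNReal.ofReal (harm q x) := by
  by_cases hx : x = 0
  · simp [hx, harm_zero]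
  · simp [hx, limitL]

omit hq0 hq in
theorem limitL_ne_top (x : ℕ) : limitL q x ≠ ∞ := by
  rw [limitL]; split_ifs <;> simp

theorem limitL_ne_zero (x : ℕ) : limitL q x ≠ 0 := by
  rw [limitL]
  split_ifs with h
  · simp
  · exact (ENNReal.ofReal_pos.2 (harm_pos hq0 hq (Nat.pos_of_ne_zero h))).ne'

theorem isKilledHarmonic_limitL : IsKilledHarmonic (bangBang q h0 h1) 0 (limitL q) := by
  refine ⟨fun x => (limitL_ne_top x).lt_top, fun x => ?_⟩
  change _ = killedStep (bangBang q h0 h1) 0 (limitL q) x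
  cases x with
  | zero => rw [killedStep_bangBang_zero]; simp [limitL, harm_one hq0 hq]
  | succ x =>
    rw [killedStep_bangBang_succ, indicator_limitL, limitL, limitL, if_neg (by omega),
      if_neg (by omega)]
    exact ofReal_step hq0 hq (harm_nonneg hq0 hq _) (harm_nonneg hq0 hq _) (harm_succ hq0 hq x)

/-- From `0` the walk jumps to `1`, so `h 0 = h 1`, and `h 1` is the coefficient of `harm`. -/
theorem IsKilledHarmonic.eq_mul_limitL {h : ℕ → ℝ≥0∞}
    (hh : IsKilledHarmonic (bangBang q h0 h1) 0 h) (x : ℕ) : h x = h 0 * limitL q x := by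
  have hk : ∀ x, h x = killedStep (bangBang q h0 h1) 0 h x := hh.2
  have e0 : h 0 = h 1 := by rw [hk 0, killedStep_bangBang_zero]
  have e := eq_mul_ofReal_harm hq0 hq (ψ := ({0}ᶜ : Set ℕ).indicator h)
    (fun x => ne_top_of_le_ne_top (hh.1 x).ne (Set.indicator_le_self _ _ _)) (by simp)
    (fun x => by
      rw [Set.indicator_of_mem (by simp), Set.indicator_of_mem (by simp), hk (x + 1),
        killedStep_bangBang_succ]) x
  rw [Set.indicator_of_mem (show 1 ∈ ({0}ᶜ : Set ℕ) by simp), ← e0] at e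
  by_cases hx : x = 0
  · simp [hx, limitL]
  · rwa [Set.indicator_of_mem (by exact hx), ← indicator_limitL,
      Set.indicator_of_mem (by exact hx)] at e

theorem isMinimalKilledHarmonic_limitL :
    IsMinimalKilledHarmonic (bangBang q h0 h1) 0 (limitL q) := by
  refine ⟨isKilledHarmonic_limitL hq0 hq, fun ψ hψ hle => ?_⟩
  have h01 : ψ 0 ≤ 1 := by simpa [limitL] using hle 0
  refine ⟨(ψ 0).toNNReal, ?_, fun x => ?_⟩
  · simpa using ENNReal.toNNReal_mono ENNReal.one_ne_top h01
  · rw [ENNReal.coe_toNNReal (hψ.1 0).ne]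
    exact IsKilledHarmonic.eq_mul_limitL hq0 hq hψ x

theorem green_zero_right (x : ℕ) :
    green (bangBang q h0 h1) 0 x 0 = Set.indicator {0} 1 x := by
  refine green_eq_of_bounded hq0 hq 0 (G := Set.indicator {0} 1) (M := 1) ENNReal.one_ne_top
    (fun x => Set.indicator_le_self _ _ _) (fun x => ?_) x
  have : killedStep (bangBang q h0 h1) 0 (Set.indicator {0} 1) x = 0 := by
    rw [killedStep_eq]
    refine ENNReal.tsum_eq_zero.2 fun z => ?_
    by_cases hz : z = 0 <;> simp [hz]
  rw [this, add_zero]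

/-- Below `y` the Green function must be a multiple of `limitL`, and beyond `y` the bounded
continuation is constant. The unit source at `y` fixes the multiple through `q * (harm q (y + 1) -
harm q y) = q * ((1 - q) / q) ^ y`. -/
theorem green_of_pos {y : ℕ} (hy : 0 < y) (x : ℕ) :
    green (bangBang q h0 h1) 0 x y =
      limitL q (min x y) * ENNReal.ofReal (1 / (q * ((1 - q) / q) ^ y)) := by
  have hα := one_lt_alpha hq0 hq
  set c := ENNReal.ofReal (1 / (q * ((1 - q) / q) ^ y)) with hc
  have hmon : ∀ x, limitL q (min x y) ≤ 1 + ENNReal.ofReal (harm q y) := by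
    intro x
    rw [limitL]
    split_ifs with h
    · exact le_self_add
    · exact le_add_left (ENNReal.ofReal_le_ofReal (harm_monotone hq0 hq (min_le_right _ _)))
  refine green_eq_of_bounded hq0 hq y (G := fun x => limitL q (min x y) * c)
    (M := (1 + ENNReal.ofReal (harm q y)) * c) ?_ ?_ ?_ x
  · exact ENNReal.mul_ne_top (by simp) ENNReal.ofReal_ne_top
  · exact fun x => mul_le_mul_left (hmon x) c
  · intro x
    cases x with
    | zero =>
      rw [killedStep_bangBang_zero, Set.indicator_of_notMem (by simp; omega), zero_add]
      simp [limitL, harm_one hq0 hq, min_eq_left (show 1 ≤ y from hy)]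
    | succ x =>
      have hind : ({0}ᶜ : Set ℕ).indicator (fun x => limitL q (min x y) * c) x =
          ENNReal.ofReal (harm q (min x y)) * c := by
        by_cases hx : x = 0
        · simp [hx, harm_zero]
        · have : min x y ≠ 0 := by omega
          simp [hx, limitL, hy.ne']
      rw [killedStep_bangBang_succ, hind]
      simp only [limitL]
      rw [if_neg (by omega), if_neg (by omega), ← mul_assoc, ← mul_assoc, ← add_mul]
      rcases lt_trichotomy (x + 1) y with h | h | h
      · rw [Set.indicator_of_notMem (by simp; omega), zero_add, min_eq_left (by omega),
          min_eq_left (by omega), min_eq_left (by omega), ← ofReal_step hq0 hq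
            (harm_nonneg hq0 hq _) (harm_nonneg hq0 hq _) (harm_succ hq0 hq x)]
      · subst h
        rw [Set.indicator_of_mem (Set.mem_singleton _), min_self, min_eq_right (by omega), min_eq_left (by omega)]
        have hpos : 0 < q * ((1 - q) / q) ^ (x + 1) := by positivity
        have e1 : (1 : ℕ → ℝ≥0∞) (x + 1) = ENNReal.ofReal (q * ((1 - q) / q) ^ (x + 1)) * c := by
          rw [hc, ← ENNReal.ofReal_mul hpos.le, mul_one_div_cancel hpos.ne']
          simp
        rw [e1, ← add_mul, ← ofReal_step hq0 hq (harm_nonneg hq0 hq _) (harm_nonneg hq0 hq _) rfl,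
          ← ENNReal.ofReal_add hpos.le]
        · congr 2
          have h2 := harm_succ hq0 hq x
          have h3 := harm_succ_sub hq0 hq (x + 1)
          rw [← h3]
          linarith
        · have := harm_nonneg hq0 hq (x + 1)
          have := harm_nonneg hq0 hq x
          have : 0 ≤ 1 - q := by linarith
          positivity
      · rw [Set.indicator_of_notMem (by simp; omega), zero_add, min_eq_right (by omega),
          min_eq_right (by omega), min_eq_right (by omega), ← ofReal_step hq0 hq
            (a := harm q y) (harm_nonneg hq0 hq _) (harm_nonneg hq0 hq _) (by ring)]

theorem martinL_bangBang (x y : ℕ) :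
    martinL (bangBang q h0 h1) 0 x y =
      if x = 0 then 1 else ENNReal.ofReal (harm q (min x y)) := by
  rw [martinL]
  rcases Nat.eq_zero_or_pos y with rfl | hy
  · rw [green_zero_right hq0 hq, green_zero_right hq0 hq]
    by_cases hx : x = 0 <;> simp [hx, harm_zero]
  · have hα := one_lt_alpha hq0 hq
    have hpos : 0 < 1 / (q * ((1 - q) / q) ^ y) := by positivity
    rw [green_of_pos hq0 hq hy, green_of_pos hq0 hq hy]
    have : limitL q (min 0 y) = 1 := by simp [limitL]
    rw [this, one_mul, ENNReal.mul_div_cancel_right (ENNReal.ofReal_pos.2 hpos).ne'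
      ENNReal.ofReal_ne_top]
    by_cases hx : x = 0
    · simp [hx, limitL]
    · rw [limitL, if_neg (by omega), if_neg hx]

theorem green_ne_top (x y : ℕ) : green (bangBang q h0 h1) 0 x y ≠ ∞ := by
  rcases Nat.eq_zero_or_pos y with rfl | hy
  · rw [green_zero_right hq0 hq]
    exact ne_top_of_le_ne_top ENNReal.one_ne_top (Set.indicator_le_self _ _ _)
  · rw [green_of_pos hq0 hq hy]
    exact ENNReal.mul_ne_top (limitL_ne_top _) ENNReal.ofReal_ne_top

theorem martinD_lt_top (z : ℕ) : martinD (bangBang q h0 h1) 0 z < ∞ := by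
  refine lt_of_le_of_lt (iSup_le fun y => ?_) (limitL_ne_top (q := q) z).lt_top
  rw [martinL_bangBang hq0 hq, limitL]
  split_ifs
  · exact le_rfl
  · exact ENNReal.ofReal_le_ofReal (harm_monotone hq0 hq (min_le_left _ _))

end BangBangChain

/-! ### The stationary probability. -/

section Stationary

variable {q : ℝ} {h0 : 0 ≤ q} {h1 : q ≤ 1}

theorem tsum_mul_bangBang_zero (b : ℕ → ℝ≥0∞) :
    ∑' x, b x * bangBang q h0 h1 x 0 = b 1 * ENNReal.ofReal (1 - q) := by
  rw [tsum_eq_single 1]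
  · rw [show (1 : ℕ) = 0 + 1 from rfl, bangBang_succ]
    simp
  · intro x hx
    cases x with
    | zero => simp [bangBang_zero]
    | succ x => rw [bangBang_succ, if_neg (by omega), if_neg (by omega)]; simp

theorem tsum_mul_bangBang_succ (b : ℕ → ℝ≥0∞) (y : ℕ) :
    ∑' x, b x * bangBang q h0 h1 x (y + 1) =
      b y * (if y = 0 then 1 else ENNReal.ofReal q) + b (y + 2) * ENNReal.ofReal (1 - q) := by
  have h : ∀ x, b x * bangBang q h0 h1 x (y + 1) =
      (if x = y then b y * (if y = 0 then 1 else ENNReal.ofReal q) else 0) +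
        (if x = y + 2 then b (y + 2) * ENNReal.ofReal (1 - q) else 0) := by
    intro x
    cases x with
    | zero =>
      rw [bangBang_zero]
      by_cases hy : y = 0
      · simp [hy]
      · simp [hy, Ne.symm hy]
    | succ x =>
      rw [bangBang_succ, mul_add]
      congr 1
      · by_cases hy : y = x + 1
        · subst hy
          simp
        · rw [if_neg (by omega), if_neg (by omega), mul_zero]
      · by_cases hy : y + 1 = x
        · subst hy
          simp
        · rw [if_neg (by omega), if_neg (by omega), mul_zero]
  simp_rw [h]
  rw [ENNReal.tsum_add, tsum_ite_eq, tsum_ite_eq]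

/-- The stationary measure normalized by the value `1` at `0`. -/
noncomputable def statMeasure (q : ℝ) (x : ℕ) : ℝ≥0∞ :=
  if x = 0 then 1 else ENNReal.ofReal (1 / (q * ((1 - q) / q) ^ x))

variable (hq0 : 0 < q) (hq : q < 1 / 2)

include hq0 hq

theorem statMeasure_balance (y : ℕ) : statMeasure q (y + 1) * ENNReal.ofReal (1 - q) =
    statMeasure q y * (if y = 0 then 1 else ENNReal.ofReal q) := by
  have h : (1 - q) ≠ 0 := by linarith
  have hα := one_lt_alpha hq0 hq
  rw [statMeasure, if_neg (by omega), ← ENNReal.ofReal_mul (by positivity), statMeasure]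
  split_ifs with hy
  · subst hy
    rw [show 1 / (q * ((1 - q) / q) ^ (0 + 1)) * (1 - q) = 1 by
      rw [zero_add, pow_one, mul_div_cancel₀ _ hq0.ne', one_div_mul_cancel h]]
    simp
  · rw [← ENNReal.ofReal_mul (by positivity)]
    congr 1
    rw [pow_succ]
    field_simp

theorem tsum_statMeasure :
    ∑' x, statMeasure q x = ENNReal.ofReal (2 * (1 - q) / (1 - 2 * q)) := by
  have hα := one_lt_alpha hq0 hq
  have h2 : 0 < 1 - 2 * q := by linarith
  have hs : HasSum (fun x : ℕ => 1 / (q * ((1 - q) / q) ^ (x + 1))) (1 / (1 - 2 * q)) := by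
    have h := (hasSum_geometric_of_lt_one (by positivity) (inv_lt_one_of_one_lt₀ hα)).mul_left
      (1 / (1 - q))
    have h3 : 1 - q ≠ 0 := by linarith
    have e1 : (fun x : ℕ => 1 / (q * ((1 - q) / q) ^ (x + 1))) =
        fun x => 1 / (1 - q) * ((1 - q) / q)⁻¹ ^ x := by
      funext x
      rw [pow_succ, inv_pow]
      field_simp
    have e2 : 1 / (1 - 2 * q) = 1 / (1 - q) * (1 - ((1 - q) / q)⁻¹)⁻¹ := by
      rw [inv_div, one_sub_div h3, inv_div, show 1 - q - q = 1 - 2 * q by ring]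
      field_simp
    rw [e1, e2]
    exact h
  rw [tsum_eq_zero_add' ENNReal.summable]
  simp only [statMeasure, if_true, Nat.succ_ne_zero, if_false]
  rw [← ENNReal.ofReal_tsum_of_nonneg (fun n => by positivity) hs.summable, hs.tsum_eq,
    ← ENNReal.ofReal_one, ← ENNReal.ofReal_add zero_le_one (by positivity)]
  congr 1
  field_simp
  ring

/-- The stationary probability of the bang-bang random walk. -/
theorem isStationaryDistribution_iff (b : ℕ → ℝ≥0∞) :
    IsStationaryDistribution (bangBang q h0 h1) b ↔
      b = fun x => ENNReal.ofReal ((1 - 2 * q) / (2 * (1 - q))) * statMeasure q x := by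
  have h2 : 0 < 1 - 2 * q := by linarith
  have h3 : 0 < 1 - q := by linarith
  have hr : ENNReal.ofReal (1 - q) ≠ 0 := (ENNReal.ofReal_pos.2 h3).ne'
  have hinv : ENNReal.ofReal ((1 - 2 * q) / (2 * (1 - q))) *
      ENNReal.ofReal (2 * (1 - q) / (1 - 2 * q)) = 1 := by
    rw [← ENNReal.ofReal_mul (by positivity), ← ENNReal.ofReal_one]
    congr 1
    field_simp
  have hsplit : ∀ a : ℝ≥0∞, a = a * ENNReal.ofReal q + a * ENNReal.ofReal (1 - q) := by
    intro a
    rw [← mul_add, ← ENNReal.ofReal_add hq0.le h3.le]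
    simp
  constructor
  · rintro ⟨hsum, hb⟩
    have hfin : ∀ x, b x ≠ ∞ := fun x =>
      ne_top_of_le_ne_top ENNReal.one_ne_top (hsum ▸ ENNReal.le_tsum x)
    -- Detailed balance follows from stationarity by induction: once the flux across one edge is
    -- balanced, cancelling it at the next state balances the next edge. The cancellation uses that
    -- `b` is finite.
    have hbal : ∀ y, b (y + 1) * ENNReal.ofReal (1 - q) =
        b y * (if y = 0 then 1 else ENNReal.ofReal q) := by
      intro y
      induction y with
      | zero => rw [if_pos rfl, mul_one, hb 0, tsum_mul_bangBang_zero]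
      | succ y ih =>
        have h := hb (y + 1)
        rw [tsum_mul_bangBang_succ, ← ih] at h
        rw [if_neg (by omega)]
        have h' := (add_comm _ _).trans ((hsplit (b (y + 1))).symm.trans h)
        exact ((ENNReal.add_right_inj (ENNReal.mul_ne_top (hfin _) ENNReal.ofReal_ne_top)).1 h').symm
    have hmul : ∀ x, b x = b 0 * statMeasure q x := by
      intro x
      induction x with
      | zero => simp [statMeasure]
      | succ x ih =>
        refine (ENNReal.mul_left_inj hr ENNReal.ofReal_ne_top).1 ?_
        rw [hbal, ih, mul_assoc, mul_assoc, statMeasure_balance hq0 hq]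
    have hb0 : b 0 = ENNReal.ofReal ((1 - 2 * q) / (2 * (1 - q))) := by
      rw [tsum_congr hmul, ENNReal.tsum_mul_left, tsum_statMeasure hq0 hq] at hsum
      rw [← hinv] at hsum
      exact (ENNReal.mul_left_inj (ENNReal.ofReal_pos.2 (by positivity)).ne'
        ENNReal.ofReal_ne_top).1 hsum
    funext x
    rw [hmul, hb0]
  · rintro rfl
    refine ⟨?_, fun y => ?_⟩
    · rw [ENNReal.tsum_mul_left, tsum_statMeasure hq0 hq, hinv]
    · simp_rw [mul_assoc]
      rw [ENNReal.tsum_mul_left]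
      congr 1
      cases y with
      | zero => rw [tsum_mul_bangBang_zero, statMeasure_balance hq0 hq, if_pos rfl, mul_one]
      | succ y =>
        rw [tsum_mul_bangBang_succ, ← statMeasure_balance hq0 hq, statMeasure_balance hq0 hq (y + 1),
          if_neg (by omega)]
        exact (hsplit _).trans (add_comm _ _)

end Stationary

/-! ### The Martin compactification and its boundary. -/

section Boundary

variable {q : ℝ} {h0 : 0 ≤ q} {h1 : q ≤ 1} (hq0 : 0 < q) (hq : q < 1 / 2) {w : ℕ → ℝ≥0}

/-- The identity map from a space to the same space with the distance `δ`. -/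
def toMartinSpace {E : Type*} (p : E → PMF E) (x₀ : E) (w : E → ℝ≥0) (x : E) :
    MartinSpace p x₀ w := x

theorem absDiff_le_max (a b : ℝ≥0∞) : absDiff a b ≤ max a b := by
  rw [absDiff]
  rcases le_total a b with h | h
  · rw [tsub_eq_zero_of_le h, zero_add]
    exact tsub_le_self.trans (le_max_right _ _)
  · rw [tsub_eq_zero_of_le h, add_zero]
    exact tsub_le_self.trans (le_max_left _ _)

theorem ind_le_one {E : Type*} (z x : E) : ind z x ≤ 1 := Set.indicator_le_self _ _ _

theorem martinDist_term_le {E : Type*} [MeasurableSpace E] [Countable E]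
    [MeasurableSingletonClass E] (p : E → PMF E) (x₀ : E) (w : E → ℝ≥0) (x y z : E) :
    (w z : ℝ≥0∞) * ((absDiff (martinL p x₀ z x) (martinL p x₀ z y) + absDiff (ind z x) (ind z y)) /
      (martinD p x₀ z + 1)) ≤ w z := by
  refine mul_le_of_le_one_right' (ENNReal.div_le_of_le_mul ?_)
  rw [one_mul]
  refine add_le_add ((absDiff_le_max _ _).trans (max_le ?_ ?_))
    ((absDiff_le_max _ _).trans (max_le (ind_le_one _ _) (ind_le_one _ _)))
  · exact le_iSup (fun y => martinL p x₀ z y) x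
  · exact le_iSup (fun y => martinL p x₀ z y) y

theorem le_martinDist {E : Type*} [MeasurableSpace E] [Countable E]
    [MeasurableSingletonClass E] (p : E → PMF E) (x₀ : E) (w : E → ℝ≥0) {x y : E} (h : x ≠ y) :
    (w x : ℝ≥0∞) * (1 / (martinD p x₀ x + 1)) ≤ martinDist p x₀ w x y := by
  refine le_trans ?_ (ENNReal.le_tsum x)
  have : absDiff (ind x x) (ind x y) = 1 := by simp [absDiff, ind, h]
  rw [this]
  gcongr
  exact le_add_self

include hq0 hq

/-- For `z < N` the kernel takes the same value at both points and both indicators vanish; each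
remaining term is at most `w z`. -/
theorem martinDist_le {N x y : ℕ} (hx : N ≤ x) (hy : N ≤ y) :
    martinDist (bangBang q h0 h1) 0 w x y ≤ ∑' z, (w (z + N) : ℝ≥0∞) := by
  rw [martinDist, ← (ENNReal.summable).sum_add_tsum_nat_add' (k := N) ]
  rw [Finset.sum_eq_zero, zero_add]
  · exact ENNReal.tsum_le_tsum fun z => martinDist_term_le _ _ _ _ _ _
  · intro z hz
    have hz := Finset.mem_range.1 hz
    have hind : ∀ t, z < t → ind z t = 0 := fun t ht =>
      Set.indicator_of_notMem (s := {t}) (a := z) ht.ne _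
    have e1 := hind x (hz.trans_le hx)
    have e2 := hind y (hz.trans_le hy)
    rw [martinL_bangBang hq0 hq, martinL_bangBang hq0 hq, min_eq_left (hz.le.trans hx),
      min_eq_left (hz.le.trans hy), e1, e2]
    simp [absDiff]

-- The space is discrete: the indicator in the coordinate `z = x` keeps all other points at a
-- positive distance from `x`.
omit hq0 hq in
theorem nhds_martinSpace {p : ℕ → PMF ℕ} (hD : ∀ z, martinD p 0 z < ∞) (hw : ∀ z, 0 < w z)
    (x : MartinSpace p 0 w) : 𝓝 x = pure x := by
  refine le_antisymm ?_ (pure_le_nhds x)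
  rw [le_pure_iff]
  have hε : 0 < (w x : ℝ≥0∞) * (1 / (martinD p 0 x + 1)) := by
    refine ENNReal.mul_pos (by simpa using (hw x).ne') ?_
    simpa using (hD x).ne
  refine mem_of_superset (Metric.eball_mem_nhds x hε) fun y hy => ?_
  by_contra hne
  have h1 := le_martinDist p 0 w (x := x) (y := y) fun h => hne h.symm
  have h2 : edist y x < _ := hy
  rw [edist_comm] at h2
  exact absurd h2 (not_lt.2 h1)

theorem exists_tendsto_toMartin (hws : Summable w) :
    ∃ a, Tendsto (toMartin (bangBang q h0 h1) 0 w) atTop (𝓝 a) := by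
  let u : ℕ → MartinSpace (bangBang q h0 h1) 0 w := fun n => n
  have hu : CauchySeq u := by
    rw [EMetric.cauchySeq_iff]
    intro ε hε
    have ht := ENNReal.tendsto_sum_nat_add (fun z => (w z : ℝ≥0∞))
      (ENNReal.tsum_coe_ne_top_iff_summable.2 hws)
    obtain ⟨N, hN⟩ := (ht.eventually (gt_mem_nhds hε)).exists
    refine ⟨N, fun m hm n hn => ?_⟩
    exact (martinDist_le hq0 hq hm hn).trans_lt hN
  have hc := UniformSpace.Completion.uniformContinuous_coe
    (MartinSpace (bangBang q h0 h1) 0 w) |>.comp_cauchySeq hu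
  exact cauchySeq_tendsto_of_complete hc

variable {a : MartinCompactification (bangBang q h0 h1) 0 w}
  (ha : Tendsto (toMartin (bangBang q h0 h1) 0 w) atTop (𝓝 a)) (hw : ∀ z, 0 < w z)

include ha hw

theorem toMartin_ne (x : ℕ) : toMartin (bangBang q h0 h1) 0 w x ≠ a := by
  intro h
  rw [← h] at ha
  have h' : Tendsto (toMartinSpace (bangBang q h0 h1) 0 w) atTop
      (𝓝 (toMartinSpace (bangBang q h0 h1) 0 w x)) :=
    (UniformSpace.Completion.isDenseInducing_coe
      (α := MartinSpace (bangBang q h0 h1) 0 w)).isInducing.tendsto_nhds_iff.2 ha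
  rw [nhds_martinSpace (fun z => martinD_lt_top hq0 hq z) hw, tendsto_pure] at h'
  obtain ⟨n, hn, hn'⟩ := (h'.and (eventually_gt_atTop x)).exists
  exact hn'.ne' hn

/-- A convergent sequence with its limit is compact, hence closed, and here it contains the dense
image of `ℕ`, so it is the whole completion. -/
theorem martinBoundary_eq : martinBoundary (bangBang q h0 h1) 0 w = {a} := by
  have hcl : IsClosed (insert a (Set.range (toMartin (bangBang q h0 h1) 0 w))) :=
    ha.isCompact_insert_range.isClosed
  have huniv : insert a (Set.range (toMartin (bangBang q h0 h1) 0 w)) = Set.univ := by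
    have hd : DenseRange (toMartin (bangBang q h0 h1) 0 w) :=
      UniformSpace.Completion.denseRange_coe (α := MartinSpace (bangBang q h0 h1) 0 w)
    refine Set.eq_univ_of_univ_subset ?_
    rw [← hd.closure_eq]
    exact hcl.closure_subset_iff.2 (Set.subset_insert _ _)
  ext b
  constructor
  · intro hb
    exact (huniv.ge (Set.mem_univ b)).resolve_right hb
  · rintro rfl ⟨x, hx⟩
    exact toMartin_ne hq0 hq ha hw x hx

/-- A neighbourhood of `a` can exclude the finitely many states below `x`, and from `x` on the
kernel is constant. -/
theorem tendsto_martinL_comap (x : ℕ) :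
    Tendsto (fun y : MartinSpace (bangBang q h0 h1) 0 w => martinL (bangBang q h0 h1) 0 x y)
      (comap (UniformSpace.Completion.coe' (α := MartinSpace (bangBang q h0 h1) 0 w)) (𝓝 a))
      (𝓝 (limitL q x)) := by
  have hfin : ((toMartin (bangBang q h0 h1) 0 w) '' Set.Iio x)ᶜ ∈ 𝓝 a := by
    refine ((Set.finite_Iio x).image _).isClosed.isOpen_compl.mem_nhds ?_
    rintro ⟨y, -, hy⟩
    exact toMartin_ne hq0 hq ha hw y hy
  have heq : ∀ y : ℕ, x ≤ y → limitL q x = martinL (bangBang q h0 h1) 0 x y := fun y hxy => by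
    rw [martinL_bangBang hq0 hq, limitL, min_eq_left hxy]
  refine tendsto_const_nhds.congr' ?_
  filter_upwards [preimage_mem_comap hfin] with y hy
  refine heq y ?_
  by_contra hc
  exact hy ⟨y, not_le.1 hc, rfl⟩

theorem martinLExt_boundary (x : ℕ) :
    martinLExt (bangBang q h0 h1) 0 w x a = limitL q x :=
  IsDenseInducing.extend_eq_of_tendsto _ (tendsto_martinL_comap hq0 hq ha hw x)

omit ha in
theorem martinLExt_toMartin (x y : ℕ) :
    martinLExt (bangBang q h0 h1) 0 w x (toMartin (bangBang q h0 h1) 0 w y) =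
      martinL (bangBang q h0 h1) 0 x y := by
  refine IsDenseInducing.extend_eq_at (a := toMartinSpace (bangBang q h0 h1) 0 w y)
    (UniformSpace.Completion.isDenseInducing_coe
      (α := MartinSpace (bangBang q h0 h1) 0 w)) ?_
  rw [ContinuousAt, nhds_martinSpace (fun z => martinD_lt_top hq0 hq z) hw]
  exact tendsto_pure_nhds _ _

theorem continuous_martinLExt (x : ℕ) : Continuous (martinLExt (bangBang q h0 h1) 0 w x) := by
  refine IsDenseInducing.continuous_extend _ fun b => ?_
  by_cases hb : b ∈ Set.range (toMartin (bangBang q h0 h1) 0 w)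
  · obtain ⟨y, rfl⟩ := hb
    refine ⟨martinL (bangBang q h0 h1) 0 x y, ?_⟩
    have : comap (UniformSpace.Completion.coe' (α := MartinSpace (bangBang q h0 h1) 0 w))
        (𝓝 (toMartin (bangBang q h0 h1) 0 w y)) =
          𝓝 (toMartinSpace (bangBang q h0 h1) 0 w y) :=
      (UniformSpace.Completion.isDenseInducing_coe.isInducing.nhds_eq_comap
        (toMartinSpace (bangBang q h0 h1) 0 w y)).symm
    rw [this, nhds_martinSpace (fun z => martinD_lt_top hq0 hq z) hw]
    exact tendsto_pure_nhds _ _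
  · have hb' : b ∈ martinBoundary (bangBang q h0 h1) 0 w := hb
    rw [martinBoundary_eq hq0 hq ha hw] at hb'
    obtain rfl : b = a := hb'
    exact ⟨_, tendsto_martinL_comap hq0 hq ha hw x⟩

theorem minimalBoundary_eq : minimalBoundary (bangBang q h0 h1) 0 w = {a} := by
  rw [minimalBoundary, martinBoundary_eq hq0 hq ha hw]
  refine Set.Subset.antisymm (fun b hb => hb.1) ?_
  rintro _ rfl
  refine ⟨rfl, ?_⟩
  simp_rw [martinLExt_boundary hq0 hq ha hw]
  exact isMinimalKilledHarmonic_limitL hq0 hq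

end Boundary

/-! ### Class `𝒬` for the walk. -/

section ClassQ

theorem IsKilledHarmonic.mul_const {E : Type*} {p : E → PMF E} {x₀ : E} {L : E → ℝ≥0∞}
    [MeasurableSpace E] [Countable E] [MeasurableSingletonClass E]
    (hL : IsKilledHarmonic p x₀ L) {c : ℝ≥0∞} (hc : c ≠ ∞) :
    IsKilledHarmonic p x₀ fun x => L x * c := by
  refine ⟨fun x => ENNReal.mul_lt_top (hL.1 x) hc.lt_top, fun x => ?_⟩
  change L x * c = _
  rw [hL.2 x, ← ENNReal.tsum_mul_right]
  refine tsum_congr fun y => ?_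
  by_cases hy : y = x₀ <;> simp [hy, mul_assoc]

variable {q : ℝ} {h0 : 0 ≤ q} {h1 : q ≤ 1} (hq0 : 0 < q) (hq : q < 1 / 2)

include hq0 hq

theorem exists_classQ_bangBang {c : ℝ≥0∞} (hc : c ≠ ∞) (hc0 : c ≠ 0) :
    ∃ Q₀ : ℕ → Measure (ℕ → ℕ),
      (∀ Q : ℕ → Measure (ℕ → ℕ), IsQFamily (bangBang q h0 h1) 0
        (fun x => ENNReal.ofReal (harm q x) * c) Q ↔ Q = Q₀) ∧
      ∀ Q : ℕ → Measure (ℕ → ℕ), ClassQ (bangBang q h0 h1) Q ↔ ∃ r : ℝ≥0, ∀ x, Q x = r • Q₀ x := by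
  have hL := (isKilledHarmonic_limitL (h0 := h0) (h1 := h1) hq0 hq).mul_const hc
  have hpos : ∀ x, limitL q x * c ≠ 0 := fun x => mul_ne_zero (limitL_ne_zero hq0 hq x) hc0
  have hφ : ∀ x, ENNReal.ofReal (harm q x) * c ≠ ∞ :=
    fun x => ENNReal.mul_ne_top ENNReal.ofReal_ne_top hc
  have hQ := isQFamily_lastExit hL hpos (green_ne_top hq0 hq)
  have e : ({0}ᶜ : Set ℕ).indicator (fun x => limitL q x * c) =
      fun x => ENNReal.ofReal (harm q x) * c := by
    funext x
    rw [← indicator_limitL]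
    by_cases hx : x = 0 <;> simp [hx]
  rw [e] at hQ
  refine ⟨lastExit hL hpos, fun Q => ⟨fun h => h.unique hφ hQ, fun h => h ▸ hQ⟩,
    classQ_iff hφ hQ (hQ.avoid_lt_top hφ (bangBang_step h0 h1)) ?_⟩
  intro ψ hψ hz hharm
  -- Since `harm q 1 = 1`, the coefficient is read off at `x = 1`.
  refine ⟨(ψ 1 / c).toNNReal, fun x => ?_⟩
  rw [ENNReal.coe_toNNReal (ENNReal.div_ne_top (hψ 1) hc0), mul_left_comm,
    ENNReal.div_mul_cancel hc0 hc, mul_comm]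
  refine eq_mul_ofReal_harm hq0 hq hψ hz (fun x => ?_) x
  rw [hharm _ (Nat.succ_ne_zero x), tsum_bangBang_succ]

end ClassQ

end MartinQ

/-! ### The main theorem: explicit formulas and assembly. -/

theorem mainTheorem11 (q : ℝ) (hq0 : 0 < q) (hq : q < 1 / 2)
    (α : ℝ) (hα : α = (1 - q) / q)
    (p : ℕ → PMF ℕ) (hp : p = bangBang q hq0.le (by linarith))
    (w : ℕ → ℝ≥0) (hw : ∀ z, 0 < w z) (hws : Summable w) :
    -- the chain
    IsMarkovFamily p (law p) ∧ IsIrreducibleChain p ∧ IsRecurrentChain p ∧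
    -- the killed Green function
    green p 0 0 0 = 1 ∧
    (∀ x > 0, green p 0 x 0 = 0) ∧
    (∀ y > 0, green p 0 0 y = ENNReal.ofReal (1 / (q * α ^ y))) ∧
    (∀ x y : ℕ, 0 < x → x ≤ y →
      green p 0 x y = ENNReal.ofReal ((α ^ x - 1) / ((1 - 2 * q) * α ^ y))) ∧
    (∀ x y : ℕ, 0 < y → y ≤ x →
      green p 0 x y = ENNReal.ofReal ((1 - (q / (1 - q)) ^ y) / (1 - 2 * q))) ∧
    -- the kernel `L_0`
    (∀ y, martinL p 0 0 y = 1) ∧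
    (∀ x > 0, ∀ y,
      martinL p 0 x y = ENNReal.ofReal (q * (α ^ min x y - 1) / (1 - 2 * q))) ∧
    (∀ z, martinD p 0 z < ∞) ∧
    -- the stationary probability
    ∃ β : ℕ → ℝ≥0∞, (∀ b : ℕ → ℝ≥0∞, IsStationaryDistribution p b ↔ b = β) ∧
      β 0 = ENNReal.ofReal ((1 - 2 * q) / (2 * (1 - q))) ∧
      (∀ x > 0, β x = ENNReal.ofReal ((1 - 2 * q) / (2 * q * (1 - q) * α ^ x))) ∧
    -- the Martin boundary
    ∃ infty : MartinCompactification p 0 w,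
      martinBoundary p 0 w = {infty} ∧
      minimalBoundary p 0 w = {infty} ∧
      Tendsto (toMartin p 0 w) atTop (𝓝 infty) ∧
      (∀ x, Continuous (martinLExt p 0 w x) ∧
        ∀ y, martinLExt p 0 w x (toMartin p 0 w y) = martinL p 0 x y) ∧
      martinLExt p 0 w 0 infty = 1 ∧
      (∀ x > 0, martinLExt p 0 w x infty =
        ENNReal.ofReal (q * (α ^ x - 1) / (1 - 2 * q))) ∧
      (∀ x, martinPhi p 0 w β infty x =
        ENNReal.ofReal (2 * q * (1 - q) / (1 - 2 * q) ^ 2 * (α ^ x - 1))) ∧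
      -- the class `𝒬`
      ∃ Qinf : ℕ → Measure (ℕ → ℕ),
        (∀ Q : ℕ → Measure (ℕ → ℕ), IsQFamily p 0 (martinPhi p 0 w β infty) Q ↔ Q = Qinf) ∧
        ∀ Q : ℕ → Measure (ℕ → ℕ), ClassQ p Q ↔ ∃ c : ℝ≥0, ∀ x, Q x = c • Qinf x := by

  have hq1 : q ≤ 1 := by linarith
  replace hp : p = bangBang q hq0.le hq1 := hp
  subst hα hp
  have h2 : 0 < 1 - 2 * q := by linarith
  have h3 : 0 < 1 - q := by linarith
  have hα := one_lt_alpha hq0 hq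
  have hmid : ∀ x y : ℕ, 0 < x → 0 < y →
      limitL q x * ENNReal.ofReal (1 / (q * ((1 - q) / q) ^ y)) =
        ENNReal.ofReal ((((1 - q) / q) ^ x - 1) / ((1 - 2 * q) * ((1 - q) / q) ^ y)) := by
    intro x y hx _
    rw [limitL, if_neg hx.ne', ← ENNReal.ofReal_mul (harm_nonneg hq0 hq x), harm]
    congr 1
    field_simp
  have hβ0 : ENNReal.ofReal ((1 - 2 * q) / (2 * (1 - q))) ≠ 0 :=
    (ENNReal.ofReal_pos.2 (by positivity)).ne'
  obtain ⟨a, ha⟩ := exists_tendsto_toMartin (h0 := hq0.le) (h1 := hq1) hq0 hq hws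
  set β : ℕ → ℝ≥0∞ :=
    fun x => ENNReal.ofReal ((1 - 2 * q) / (2 * (1 - q))) * statMeasure q x with hβ
  have hb0 : β 0 = ENNReal.ofReal ((1 - 2 * q) / (2 * (1 - q))) := by simp [hβ, statMeasure]
  -- The indicator off `0` is absorbed because `harm` vanishes at `0`; this is the form expected by
  -- `exists_classQ_bangBang`.
  have hphi : martinPhi (bangBang q hq0.le hq1) 0 w β a = fun x =>
      ENNReal.ofReal (harm q x) * (ENNReal.ofReal ((1 - 2 * q) / (2 * (1 - q))))⁻¹ := by
    funext x
    rw [← indicator_limitL, martinPhi, hb0]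
    by_cases hx : x = 0
    · simp [hx]
    · rw [Set.indicator_of_mem (by exact hx), Set.indicator_of_mem (by exact hx),
        martinLExt_boundary hq0 hq ha hw, div_eq_mul_inv]
  refine ⟨isMarkovFamily_law _, isIrreducibleChain_bangBang hq0 hq,
    isRecurrentChain_bangBang hq0 hq, ?_, fun x hx => ?_, fun y hy => ?_, fun x y hx hxy => ?_,
    fun x y hy hyx => ?_, fun y => ?_, fun x hx y => ?_, martinD_lt_top hq0 hq,
    β, isStationaryDistribution_iff hq0 hq, hb0, fun x hx => ?_, a, martinBoundary_eq hq0 hq ha hw,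
    minimalBoundary_eq hq0 hq ha hw, ha,
    fun x => ⟨continuous_martinLExt hq0 hq ha hw x, martinLExt_toMartin hq0 hq hw x⟩, ?_,
    fun x hx => ?_, fun x => ?_, ?_⟩
  · rw [green_zero_right hq0 hq]
    simp
  · rw [green_zero_right hq0 hq, Set.indicator_of_notMem (s := {0}) (by simpa using hx.ne')]
  · rw [green_of_pos hq0 hq hy]
    simp [limitL]
  · rw [green_of_pos hq0 hq (hx.trans_le hxy), min_eq_left hxy, hmid x y hx (hx.trans_le hxy)]
  · rw [green_of_pos hq0 hq hy, min_eq_right hyx, hmid y y hy hy]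
    congr 1
    have : (q / (1 - q)) ^ y = (((1 - q) / q) ^ y)⁻¹ := by rw [← inv_pow, inv_div]
    rw [this]
    field_simp
  · rw [martinL_bangBang hq0 hq, if_pos rfl]
  · rw [martinL_bangBang hq0 hq, if_neg hx.ne', harm]
  · rw [hβ]
    simp only
    rw [statMeasure, if_neg hx.ne', ← ENNReal.ofReal_mul (by positivity)]
    congr 1
    field_simp
  · rw [martinLExt_boundary hq0 hq ha hw]
    simp [limitL]
  · rw [martinLExt_boundary hq0 hq ha hw, limitL, if_neg hx.ne', harm]
  · rw [hphi]
    simp only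
    rw [← ENNReal.ofReal_inv_of_pos (by positivity),
      ← ENNReal.ofReal_mul (harm_nonneg hq0 hq x), harm]
    congr 1
    field_simp
  · rw [hphi]
    exact exists_classQ_bangBang hq0 hq (ENNReal.inv_ne_top.2 hβ0)
      (ENNReal.inv_ne_zero.2 ENNReal.ofReal_ne_top)
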